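/- **Model.** For integers $n,k\ge 1$, reals $a,b$ and $p\in(0,1]$, a sample $(G,\sigma,R)\sim\mathcal G(n,k,a,b,p)$ is generated as follows: each node $v\in[n]$ receives an independent uniform label $\sigma_v\in\{1,\dots,k\}$; given the labels, each pair $\{u,v\}$ is joined by an edge independently, with probability $a/n$ if $\sigma_u=\sigma_v$ and $b/n$ otherwise; each node belongs to the set $R$ of revealed nodes independently with probability $p$. An algorithm sees $G$, $R$ and the labels $\sigma_R$ of the revealed nodes. **Algorithm** (radius $r$, maximal degree $D$). A node $v\in R$ keeps its revealed label. For $v\notin R$, let $G_r(v)$ be the subgraph induced on the nodes at distance at most $r$ from $v$, rooted at $v$; call $w$ an ancestor of $x$ if $w$ lies on a shortest path from $v$ to $x$ (so $x$ and $v$ are ancestors of $x$). Delete from $G_r(v)$ every subtree rooted at a node of degree larger than $D$, i.e. delete every node with an ancestor of degree larger than $D$ in $G_r(v)$. Let $L$ be the set of labels $l$ for which there remain $x,y\in R$ with $\sigma_x=\sigma_y=l$, both at distance exactly $r$ from $v$, whose first common ancestor is $v$ (they have no common ancestor other than $v$). Assign to $v$ a uniformly random element of $L$ (no label if $L=\emptyset$).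 This is a local algorithm: it only uses $G_r(v)$ and the revealed labels in it. **Theorem.** Let $b>1$ and $\delta>0$, and for each $k$ put $a=b+(1+\delta)k$. There are $\varepsilon=\varepsilon(b,\delta)>0$ and $D=D(b,\delta)$ such that for every $p\in(0,1]$ there are $r=r(b,\delta,p)$ and $k^*=k^*(b,\delta,p)$ such that for every $k\ge k^*$ and all sufficiently large $n$ (depending on $b,\delta,p,k$), if $(G,\sigma,R)\sim\mathcal G(n,k,a,b,p)$ and $v$ is an independent uniformly random node, then the algorithm with radius $r$ and maximal degree $D$ labels $v$ correctly with probability at least $\varepsilon$, and moreover $$\Pr[v\notin R \text{ and } v \text{ is labeled correctly}]\ \ge\ \varepsilon\,\Pr[v\notin R].$$ In particular, recovery is possible in some settings with $(a-b)^2<k(a+(k-1)b)$: there are $b>1$, $\delta>0$, $\varepsilon>0$ and $D$ such that for every $p\in(0,1]$ there are $r$ and $k^*$ such that for every $k\ge k^*$, with $a=b+(1+\delta)k$, one has $(a-b)^2<k(a+(k-1)b)$ and, for all sufficiently large $n$, the algorithm labels $v$ correctly with probability at least $\frac1k+\varepsilon$, and $\Pr[v\notin R \text{ and } v\text{ is labeled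 correctly}]\ge(\frac1k+\varepsilon)\Pr[v\notin R]$. -/

import Mathlib

open Filter
open scoped ENNReal

noncomputable section

/-- The law of a random subset of a finite type that contains each element `i` with
probability `q i`, independently over `i`. -/
def randomSubset {ι : Type*} [Fintype ι] [DecidableEq ι] (q : ι → unitInterval) :
    PMF (Finset ι) :=
  PMF.ofFintype
    (fun S => (∏ i ∈ S, ENNReal.ofReal (q i)) *
      ∏ i ∈ Finset.univ \ S, ENNReal.ofReal (1 - q i))
    (by
      rw [← Finset.powerset_univ,
        ← Finset.prod_add (fun i => ENNReal.ofReal (q i)) (fun i => ENNReal.ofReal (1 - q i))]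
      refine Finset.prod_eq_one fun i _ => ?_
      rw [← ENNReal.ofReal_add (q i).2.1 (by linarith [(q i).2.2])]
      simp)

/-- The connection probability of the unordered pair `e` in the block model on `n` nodes with
labels `σ`: it is `a / n` if the two endpoints have equal labels and `b / n` otherwise.
(The projection to `[0, 1]` has no effect once `0 ≤ a, b ≤ n`.) -/
def edgeProbability {n k : ℕ} (a b : ℝ) (σ : Fin n → Fin k) (e : Sym2 (Fin n)) : unitInterval :=
  open Classical in
  Set.projIcc (0 : ℝ) 1 zero_le_one (if (e.map σ).IsDiag then a / n else b / n)

/-- A sample of the labeled block model: a graph, the true labels, and the set of nodes whose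
label is revealed. -/
structure LabeledGraph (n k : ℕ) where
  graph : SimpleGraph (Fin n)
  label : Fin n → Fin k
  revealed : Finset (Fin n)

/-- The labeled block model `G(n, k, a, b, p)`: labels are independent and uniform on the `k`
labels, the edges are independent given the labels, and each node is revealed with
probability `p` independently of everything else. -/
def labeledBlockModel (n k : ℕ) [NeZero k] (a b : ℝ) (p : unitInterval) :
    PMF (LabeledGraph n k) :=
  (PMF.uniformOfFintype (Fin n → Fin k)).bind fun σ =>
    (randomSubset (edgeProbability a b σ)).bind fun E =>
      (randomSubset fun _ : Fin n => p).map fun R =>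
        ⟨SimpleGraph.fromEdgeSet (E : Set (Sym2 (Fin n))), σ, R⟩

/-- What a clustering algorithm sees of the labels: those of the revealed nodes. -/
def LabeledGraph.observed {n k : ℕ} (X : LabeledGraph n k) (u : Fin n) : Option (Fin k) :=
  if u ∈ X.revealed then some (X.label u) else none

section Algorithm

variable {V : Type*} {k : ℕ}

/-- The subgraph of `G` induced on the nodes at distance at most `r` from `v` (the other nodes
are kept as isolated points). -/
def neighborhood (G : SimpleGraph V) (v : V) (r : ℕ) : SimpleGraph V where
  Adj u w := G.Adj u w ∧ G.edist v u ≤ r ∧ G.edist v w ≤ r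
  symm := ⟨fun _ _ h => ⟨h.1.symm, h.2.2, h.2.1⟩⟩
  loopless := ⟨fun _ h => h.1.ne rfl⟩

/-- The observed labels at distance at most `r` from `v`. -/
def observedNear (G : SimpleGraph V) (obs : V → Option (Fin k)) (v : V) (r : ℕ) :
    V → Option (Fin k) :=
  open Classical in fun u => if G.edist v u ≤ r then obs u else none

/-- `w` is an ancestor of `x` in `H` rooted at `v`: it lies on a shortest path from `v` to `x`.
Every node is an ancestor of itself, and the root is an ancestor of every node. -/
def IsAncestor (H : SimpleGraph V) (v w x : V) : Prop :=
  H.edist v w + H.edist w x = H.edist v x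

/-- `x` remains after deletion of every subtree rooted at a node of degree larger than `D`. -/
def Survives (H : SimpleGraph V) (D : ℕ) (v x : V) : Prop :=
  ∀ w, IsAncestor H v w x → (H.neighborSet w).ncard ≤ D

/-- The root `v` is the first common ancestor of `x` and `y`: they have no other one. -/
def RootIsFirstCommonAncestor (H : SimpleGraph V) (v x y : V) : Prop :=
  ∀ w, IsAncestor H v w x → IsAncestor H v w y → w = v

/-- The labels `l` for which, after the deletion, there are two revealed nodes `x`, `y` of label
`l` at distance `r` from `v` with first common ancestor `v`. -/
def candidateLabels (H : SimpleGraph V) (obs : V → Option (Fin k)) (D r : ℕ) (v : V) :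
    Finset (Fin k) :=
  open Classical in
  Finset.univ.filter fun l => ∃ x y : V,
    obs x = some l ∧ obs y = some l ∧
    H.edist v x = r ∧ H.edist v y = r ∧
    Survives H D v x ∧ Survives H D v y ∧
    RootIsFirstCommonAncestor H v x y

/-- The rule applied at `v` to a rooted neighborhood `H` and its observed labels: a revealed node
keeps its label, any other node receives a uniformly random candidate label (none if there is
no candidate). -/
def chooseLabel (H : SimpleGraph V) (obs : V → Option (Fin k)) (D r : ℕ) (v : V) :
    PMF (Option (Fin k)) :=
  open Classical in
  match obs v with
  | some l => PMF.pure (some l)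
  | none =>
    if h : (candidateLabels H obs D r v).Nonempty then
      (PMF.uniformOfFinset (candidateLabels H obs D r v) h).map some
    else PMF.pure none

/-- The local algorithm with radius `r` and maximal degree `D`, at the node `v` of a graph `G`
with observed labels `obs`. It uses only the `r`-neighborhood of `v`. -/
def localAlgorithm (G : SimpleGraph V) (obs : V → Option (Fin k)) (D r : ℕ) (v : V) :
    PMF (Option (Fin k)) :=
  chooseLabel (neighborhood G v r) (observedNear G obs v r) D r v

end Algorithm

/-- One run: a sample of the model, a node, and the label that the algorithm gives to it. -/
structure Run (n k : ℕ) where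
  sample : LabeledGraph n k
  node : Fin n
  output : Option (Fin k)

/-- The node is labeled correctly. -/
def Run.Correct {n k : ℕ} (X : Run n k) : Prop :=
  X.output = some (X.sample.label X.node)

/-- The label of the node is revealed. -/
def Run.IsRevealed {n k : ℕ} (X : Run n k) : Prop :=
  X.node ∈ X.sample.revealed

/-- The law of a run: a sample of `G(n, k, a, b, p)`, an independent uniformly random node, and
the output of the algorithm with maximal degree `D` and radius `r` there. -/
def runLaw (n k : ℕ) [NeZero n] [NeZero k] (a b : ℝ) (p : unitInterval) (D r : ℕ) :
    PMF (Run n k) :=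
  (labeledBlockModel n k a b p).bind fun X =>
    (PMF.uniformOfFintype (Fin n)).bind fun v =>
      (localAlgorithm X.graph X.observed D r v).map fun o => ⟨X, v, o⟩

/-- The probability of an event under a discrete law. -/
def probability {α : Type*} (μ : PMF α) (E : α → Prop) : ℝ :=
  (μ.toOuterMeasure {x | E x}).toReal

end

/-! Nodes with the label of `v` span a sparse random graph with about `n / k` nodes and edge
probability `a / n`. Its mean degree is `a / k = 1 + δ + b / k`, so its local branching is
supercritical, uniformly in `k`. The cluster of `v` inside its own label class therefore grows
geometrically with probability bounded below by a function of `b` and `δ`. It does so in two groups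
that leave `v` through different neighbors, even when nodes of degree above a constant `D` are cut
off. Once both groups at distance `r` are large compared with `1 / p`, each is likely to contain a
revealed node, and the true label is a candidate. This is `exists_bprob_growsUntil_ge`. A wrong
label is a candidate only if two paths of length `r` that meet only in `v` end at nodes of that
label. Disjoint paths have disjoint edges, so for each label the probability is at most the square
of an expected number of walks, `(Λ ^ r / k) ^ 2` with `Λ = 3 * b + 2 * (1 + δ)`. Summed over fewer
than `k` labels this is at most `Λ ^ (2 * r) / k`, which is negligible for fixed `r` and large `k`
(`bprob_hasForeignPair_le_div`). With probability bounded below, the true label is then the only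
candidate. The proof of growth explores the class breadth first. Given the history, the offspring of
the current generation depend on unexamined pairs only, so Chebyshev's inequality makes a stall at
step `j` unlikely, with a bound decaying like `μ ^ (-j)` for some `μ > 1`. If each group starts with
sufficiently many nodes `z`, these bounds sum to at most `1 / 2` (`bprob_growsUntil_ge`). Starting
with `z` nodes has a fixed positive probability. Hence `ε` and `D` do not depend on `p`; only the
depth, and through it `kstar`, does. Two events are discarded: failure of uniqueness of short paths
from `v`, of probability `O(1 / n)` (`bprob_not_uniquePaths_le`), and unbalanced label classes,
which cover at most half of the labelings (`card_balanced_ge`). The second claim follows from the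
first, since `1 / k` tends to zero while `ε` is fixed. -/

/-! ### Expectation, independence and moment inequalities for random subsets. -/

section BernoulliSubset

variable {ι : Type*} [Fintype ι] [DecidableEq ι]

/-- The expectation of `f` under the law of a random subset with inclusion probabilities `q`. -/
noncomputable def bexp (q : ι → unitInterval) (f : Finset ι → ℝ) : ℝ :=
  ∑ S, ((∏ i ∈ S, (q i : ℝ)) * ∏ i ∈ Finset.univ \ S, (1 - (q i : ℝ))) * f S

/-- The probability of `E` under the law of a random subset. -/
noncomputable def bprob (q : ι → unitInterval) (E : Set (Finset ι)) : ℝ :=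
  bexp q (E.indicator 1)

variable (q : ι → unitInterval)

theorem bexp_weight_nonneg (S : Finset ι) :
    0 ≤ (∏ i ∈ S, (q i : ℝ)) * ∏ i ∈ Finset.univ \ S, (1 - (q i : ℝ)) :=
  mul_nonneg (Finset.prod_nonneg fun i _ => (q i).2.1)
    (Finset.prod_nonneg fun i _ => sub_nonneg.2 (q i).2.2)

theorem bexp_mono {f g : Finset ι → ℝ} (h : ∀ S, f S ≤ g S) : bexp q f ≤ bexp q g :=
  Finset.sum_le_sum fun S _ => mul_le_mul_of_nonneg_left (h S) (bexp_weight_nonneg q S)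

theorem bexp_add (f g : Finset ι → ℝ) : bexp q (fun S => f S + g S) = bexp q f + bexp q g := by
  simp only [bexp, mul_add, Finset.sum_add_distrib]

theorem bexp_sub (f g : Finset ι → ℝ) : bexp q (fun S => f S - g S) = bexp q f - bexp q g := by
  simp only [bexp, mul_sub, Finset.sum_sub_distrib]

theorem bexp_const_mul (c : ℝ) (f : Finset ι → ℝ) :
    bexp q (fun S => c * f S) = c * bexp q f := by
  simp only [bexp, Finset.mul_sum]
  exact Finset.sum_congr rfl fun _ _ => by ring

theorem bexp_sum {κ : Type*} (s : Finset κ) (f : κ → Finset ι → ℝ) :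
    bexp q (fun S => ∑ i ∈ s, f i S) = ∑ i ∈ s, bexp q (f i) := by
  simp only [bexp, Finset.mul_sum]
  exact Finset.sum_comm

theorem bexp_const (c : ℝ) : bexp q (fun _ => c) = c := by
  have h := Finset.prod_add (fun i => (q i : ℝ)) (fun i => 1 - (q i : ℝ)) Finset.univ
  rw [Finset.powerset_univ] at h
  simp only [bexp, ← Finset.sum_mul, ← h]
  simp

theorem bexp_nonneg {f : Finset ι → ℝ} (h : ∀ S, 0 ≤ f S) : 0 ≤ bexp q f := by
  simpa [bexp_const] using bexp_mono q h

/-- The function `f` of a finite set depends only on which elements of `I` it contains. -/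
def DependsOnCoords {β : Type*} (f : Finset ι → β) (I : Finset ι) : Prop :=
  ∀ S T, S ∩ I = T ∩ I → f S = f T

omit [Fintype ι] in
theorem DependsOnCoords.mono {β : Type*} {f : Finset ι → β} {I J : Finset ι}
    (h : DependsOnCoords f I) (hIJ : I ⊆ J) : DependsOnCoords f J := by
  intro S T hST
  apply h
  have := congrArg (· ∩ I) hST
  simpa [Finset.inter_assoc, Finset.inter_eq_right.2 hIJ] using this

/-- Every `S` is uniquely `A ∪ B` with `A ⊆ I` and `B ⊆ Iᶜ`, and the weight of `S` is the product of
the weights of the parts. Normalizing the two factors to expectations is left to the next lemma. -/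
theorem bexp_split (I : Finset ι) (f g : Finset ι → ℝ) (hf : DependsOnCoords f I)
    (hg : DependsOnCoords g Iᶜ) :
    bexp q (fun S => f S * g S) =
      (∑ A ∈ I.powerset, ((∏ i ∈ A, (q i : ℝ)) * ∏ i ∈ I \ A, (1 - (q i : ℝ))) * f A) *
      ∑ B ∈ Iᶜ.powerset, ((∏ i ∈ B, (q i : ℝ)) * ∏ i ∈ Iᶜ \ B, (1 - (q i : ℝ))) * g B := by
  rw [Finset.sum_mul_sum, ← Finset.sum_product', bexp]
  symm
  refine Finset.sum_nbij' (fun x => x.1 ∪ x.2) (fun S => (S ∩ I, S ∩ Iᶜ)) ?_ ?_ ?_ ?_ ?_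
  · simp
  · intro S _
    simp [Finset.inter_subset_right]
  · rintro ⟨A, B⟩ h
    simp only [Finset.mem_product, Finset.mem_powerset] at h
    ext x
    · simp only [Finset.mem_inter, Finset.mem_union]
      have h1 := @h.1 x
      have h2 := @h.2 x
      simp only [Finset.mem_compl] at h2
      tauto
    · simp only [Finset.mem_inter, Finset.mem_union, Finset.mem_compl]
      have h1 := @h.1 x
      have h2 := @h.2 x
      simp only [Finset.mem_compl] at h2
      tauto
  · intro S _
    ext x
    simp only [Finset.mem_inter, Finset.mem_union, Finset.mem_compl]
    tauto
  · rintro ⟨A, B⟩ h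
    simp only [Finset.mem_product, Finset.mem_powerset] at h
    have hd : Disjoint A B :=
      Finset.disjoint_of_subset_left h.1
        (Finset.disjoint_of_subset_right h.2 disjoint_compl_right)
    have hd' : Disjoint (I \ A) (Iᶜ \ B) :=
      Finset.disjoint_of_subset_left Finset.sdiff_subset
        (Finset.disjoint_of_subset_right Finset.sdiff_subset disjoint_compl_right)
    have hU : Finset.univ \ (A ∪ B) = (I \ A) ∪ (Iᶜ \ B) := by
      ext x
      have h1 := @h.1 x
      have h2 := @h.2 x
      simp only [Finset.mem_compl] at h2
      simp only [Finset.mem_sdiff, Finset.mem_univ, true_and, Finset.mem_union,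
        Finset.mem_compl]
      tauto
    have e1 : f (A ∪ B) = f A := by
      apply hf
      ext x
      have h1 := @h.1 x
      have h2 := @h.2 x
      simp only [Finset.mem_compl] at h2
      simp only [Finset.mem_inter, Finset.mem_union]
      tauto
    have e2 : g (A ∪ B) = g B := by
      apply hg
      ext x
      have h1 := @h.1 x
      have h2 := @h.2 x
      simp only [Finset.mem_compl] at h2
      simp only [Finset.mem_inter, Finset.mem_union, Finset.mem_compl]
      tauto
    simp only [hU, Finset.prod_union hd, Finset.prod_union hd', e1, e2]
    ring

/-- Functions of disjoint sets of coordinates are uncorrelated. -/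
theorem bexp_mul_of_disjoint {I J : Finset ι} (hIJ : Disjoint I J) {f g : Finset ι → ℝ}
    (hf : DependsOnCoords f I) (hg : DependsOnCoords g J) :
    bexp q (fun S => f S * g S) = bexp q f * bexp q g := by
  have hg' : DependsOnCoords g Iᶜ :=
    hg.mono fun x hx => Finset.mem_compl.2 fun hxI => Finset.disjoint_left.1 hIJ hxI hx
  have h1 : ∀ K : Finset ι, DependsOnCoords (fun _ : Finset ι => (1 : ℝ)) K := fun _ _ _ _ => rfl
  -- With `s`, `t` the total weights on `I` and `Iᶜ`, the four splittings say that the expectations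
  -- of `f * g`, `f`, `g` and `1` are `x * y`, `x * t`, `s * y` and `s * t = 1`.
  have a := bexp_split q I f g hf hg'
  have b := bexp_split q I f (fun _ => 1) hf (h1 _)
  have c := bexp_split q I (fun _ => 1) g (h1 _) hg'
  have d := bexp_split q I (fun _ => 1) (fun _ => 1) (h1 _) (h1 _)
  simp only [mul_one, one_mul] at b c d
  rw [bexp_const] at d
  rw [a, b, c]
  generalize (∑ A ∈ I.powerset, ((∏ i ∈ A, (q i : ℝ)) * ∏ i ∈ I \ A, (1 - (q i : ℝ))) * f A) = x
    at *
  generalize (∑ B ∈ Iᶜ.powerset, ((∏ i ∈ B, (q i : ℝ)) * ∏ i ∈ Iᶜ \ B, (1 - (q i : ℝ))) * g B)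
    = y at *
  linear_combination (x * y) * d

theorem bprob_nonneg (E : Set (Finset ι)) : 0 ≤ bprob q E :=
  bexp_nonneg q fun S => Set.indicator_nonneg (fun _ _ => zero_le_one) S

theorem bprob_mono {E F : Set (Finset ι)} (h : E ⊆ F) : bprob q E ≤ bprob q F :=
  bexp_mono q fun S => Set.indicator_le_indicator_of_subset h (fun _ => zero_le_one) S

theorem bprob_iUnion_le {κ : Type*} (s : Finset κ) (E : κ → Set (Finset ι)) :
    bprob q (⋃ i ∈ s, E i) ≤ ∑ i ∈ s, bprob q (E i) := by
  simp only [bprob]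
  rw [← bexp_sum]
  refine bexp_mono q fun S => ?_
  have hnn : ∀ i ∈ s, 0 ≤ (E i).indicator (1 : Finset ι → ℝ) S :=
    fun i _ => Set.indicator_nonneg (fun _ _ => zero_le_one) S
  by_cases h : S ∈ ⋃ i ∈ s, E i
  · rw [Set.indicator_of_mem h]
    simp only [Set.mem_iUnion] at h
    obtain ⟨i, hi, hS⟩ := h
    refine le_trans ?_ (Finset.single_le_sum hnn hi)
    rw [Set.indicator_of_mem hS]
  · rw [Set.indicator_of_notMem h]
    exact Finset.sum_nonneg hnn

theorem bprob_union_le (E F : Set (Finset ι)) : bprob q (E ∪ F) ≤ bprob q E + bprob q F := by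
  simp only [bprob]
  rw [← bexp_add]
  refine bexp_mono q fun S => ?_
  classical
  simp only [Set.indicator_apply, Set.mem_union, Pi.one_apply]
  split_ifs <;> first | tauto | norm_num

/-- Markov's inequality. -/
theorem bprob_mul_le {E : Set (Finset ι)} {f : Finset ι → ℝ} {c : ℝ} (hf : ∀ S, 0 ≤ f S)
    (h : ∀ S ∈ E, c ≤ f S) : c * bprob q E ≤ bexp q f := by
  rw [bprob, ← bexp_const_mul]
  refine bexp_mono q fun S => ?_
  by_cases hS : S ∈ E
  · simpa [Set.indicator_of_mem hS] using h S hS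
  · simpa [Set.indicator_of_notMem hS] using hf S

theorem bprob_inter_of_disjoint {I J : Finset ι} (hIJ : Disjoint I J) {E F : Set (Finset ι)}
    (hE : DependsOnCoords (· ∈ E) I) (hF : DependsOnCoords (· ∈ F) J) :
    bprob q (E ∩ F) = bprob q E * bprob q F := by
  have aux : ∀ {E : Set (Finset ι)} {I : Finset ι}, DependsOnCoords (· ∈ E) I →
      DependsOnCoords (E.indicator (1 : Finset ι → ℝ)) I := by
    intro E I h S T hST
    have := h S T hST
    classical
    simp only [Set.indicator_apply]
    simp only [eq_iff_iff] at this
    simp [this]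
  rw [bprob, bprob, bprob, ← bexp_mul_of_disjoint q hIJ (aux hE) (aux hF)]
  congr 1
  rw [Set.inter_indicator_one]
  rfl

theorem bprob_compl (E : Set (Finset ι)) : bprob q Eᶜ = 1 - bprob q E := by
  have h := bexp_sub q (fun _ => (1 : ℝ)) (E.indicator 1)
  rw [bexp_const] at h
  rw [bprob, bprob, ← h]
  congr 1
  funext S
  classical
  simp only [Set.indicator_apply, Set.mem_compl_iff, Pi.one_apply]
  split_ifs <;> simp

theorem bprob_mem (i : ι) : bprob q {S | i ∈ S} = q i := by
  have hd : DependsOnCoords (Set.indicator {S : Finset ι | i ∈ S} (1 : Finset ι → ℝ)) {i} := by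
    intro S T h
    have : i ∈ S ↔ i ∈ T := by
      have := congrArg (i ∈ ·) h
      simpa using this
    classical
    simp [Set.indicator_apply, this]
  have h := bexp_split q {i} _ (fun _ => 1) hd (fun _ _ _ => rfl)
  have d := Finset.prod_add (fun i => (q i : ℝ)) (fun i => 1 - (q i : ℝ)) {i}ᶜ
  simp only [mul_one] at h
  have hp : ({i} : Finset ι).powerset = {∅, {i}} := by
    ext A
    simp [Finset.subset_singleton_iff]
  rw [bprob, h, ← d, hp, Finset.sum_pair (Finset.singleton_ne_empty i).symm]
  simp

/-- The probability that a random subset contains `s`. -/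
theorem bprob_subset (s : Finset ι) : bprob q {S | s ⊆ S} = ∏ i ∈ s, (q i : ℝ) := by
  induction s using Finset.induction_on with
  | empty =>
    simp only [Finset.empty_subset, Set.ofPred_true, bprob, Set.indicator_univ, Finset.prod_empty]
    exact bexp_const q 1
  | insert i s hi ih =>
    have : {S : Finset ι | insert i s ⊆ S} = {S | i ∈ S} ∩ {S | s ⊆ S} := by
      ext S
      simp [Finset.insert_subset_iff]
    rw [this, bprob_inter_of_disjoint q (I := {i}) (J := s) (by simpa using hi), bprob_mem, ih,
      Finset.prod_insert hi]
    · intro S T h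
      have := congrArg (i ∈ ·) h
      simpa using this
    · intro S T h
      simp only [Set.mem_ofPred_eq, eq_iff_iff]
      rw [← Finset.inter_eq_right, h, Finset.inter_eq_right]

/-- The probability that a random subset avoids `s`. -/
theorem bprob_disjoint (s : Finset ι) :
    bprob q {S | Disjoint s S} = ∏ i ∈ s, (1 - (q i : ℝ)) := by
  induction s using Finset.induction_on with
  | empty =>
    simp only [Finset.disjoint_empty_left, Set.ofPred_true, bprob, Set.indicator_univ,
      Finset.prod_empty]
    exact bexp_const q 1
  | insert i s hi ih =>
    have : {S : Finset ι | Disjoint (insert i s) S} = {S | i ∈ S}ᶜ ∩ {S | Disjoint s S} := by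
      ext S
      simp
    rw [this, bprob_inter_of_disjoint q (I := {i}) (J := s) (by simpa using hi), bprob_compl,
      bprob_mem, ih, Finset.prod_insert hi]
    · intro S T h
      have := congrArg (i ∈ ·) h
      simpa [not_iff_not] using this
    · intro S T h
      simp only [Set.mem_ofPred_eq, eq_iff_iff]
      rw [Finset.disjoint_iff_inter_eq_empty, Finset.disjoint_iff_inter_eq_empty,
        Finset.inter_comm, h, Finset.inter_comm]

/-- Chebyshev's inequality for the lower tail of a sum of independent functions. -/
theorem bprob_sum_lt {κ : Type*} [DecidableEq κ] (U : Finset κ) (X : κ → Finset ι → ℝ)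
    (I : κ → Finset ι) (hX : ∀ u ∈ U, DependsOnCoords (X u) (I u))
    (hI : ∀ u ∈ U, ∀ w ∈ U, u ≠ w → Disjoint (I u) (I w)) {m μ V : ℝ} (hμ : μ < m)
    (hV0 : 0 ≤ V) (hm : ∀ u ∈ U, m ≤ bexp q (X u)) (hV : ∀ u ∈ U, bexp q (fun S => X u S ^ 2) ≤ V) :
    (m - μ) ^ 2 * U.card * bprob q {S | ∑ u ∈ U, X u S < μ * U.card} ≤ V := by
  rcases U.eq_empty_or_nonempty with rfl | hU
  · simpa using hV0
  have hc : (0 : ℝ) < U.card := by exact_mod_cast hU.card_pos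
  set Y : κ → Finset ι → ℝ := fun u S => X u S - bexp q (X u) with hY
  have hY0 : ∀ u, bexp q (Y u) = 0 := fun u => by
    simp only [hY]
    rw [bexp_sub, bexp_const, sub_self]
  have hYd : ∀ u ∈ U, DependsOnCoords (Y u) (I u) := fun u hu S T h => by
    simp only [hY, hX u hu S T h]
  have hvar : bexp q (fun S => (∑ u ∈ U, Y u S) ^ 2) ≤ V * U.card := by
    have e : (fun S => (∑ u ∈ U, Y u S) ^ 2) =
        fun S => ∑ u ∈ U, ∑ w ∈ U, Y u S * Y w S := by
      funext S
      rw [sq, Finset.sum_mul_sum]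
    rw [e, bexp_sum]
    have : ∀ u ∈ U, bexp q (fun S => ∑ w ∈ U, Y u S * Y w S) ≤ V := by
      intro u hu
      -- Only the diagonal term survives; it is a variance, hence at most the second moment `V`.
      rw [bexp_sum, Finset.sum_eq_single_of_mem u hu]
      · have e2 : (fun S => Y u S * Y u S) =
            fun S => (X u S ^ 2 - (2 * bexp q (X u)) * X u S) + bexp q (X u) ^ 2 := by
          funext S
          simp only [hY]
          ring
        rw [e2, bexp_add, bexp_sub, bexp_const_mul, bexp_const]
        nlinarith [hV u hu, sq_nonneg (bexp q (X u))]
      · intro w hw hwu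
        rw [bexp_mul_of_disjoint q (hI u hu w hw hwu.symm) (hYd u hu) (hYd w hw), hY0, zero_mul]
    calc _ ≤ ∑ _u ∈ U, V := Finset.sum_le_sum this
      _ = V * U.card := by rw [Finset.sum_const, nsmul_eq_mul, mul_comm]
  have hmk := bprob_mul_le q (E := {S | ∑ u ∈ U, X u S < μ * U.card})
    (f := fun S => (∑ u ∈ U, Y u S) ^ 2) (c := ((m - μ) * U.card) ^ 2)
    (fun S => sq_nonneg _) (by
      intro S hS
      simp only [Set.mem_ofPred_eq] at hS
      have h1 : m * U.card ≤ ∑ u ∈ U, bexp q (X u) := by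
        calc m * U.card = ∑ _u ∈ U, m := by rw [Finset.sum_const, nsmul_eq_mul, mul_comm]
          _ ≤ _ := Finset.sum_le_sum hm
      have h2 : ∑ u ∈ U, Y u S = ∑ u ∈ U, X u S - ∑ u ∈ U, bexp q (X u) := by
        simp only [hY, Finset.sum_sub_distrib]
      rw [← neg_sq (∑ u ∈ U, Y u S)]
      apply pow_le_pow_left₀ (mul_nonneg (by linarith) hc.le)
      rw [h2]
      linarith)
  have := hmk.trans hvar
  -- The squared deviation carries `U.card ^ 2` and the variance only `U.card`; cancelling one
  -- factor leaves the gain from averaging.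
  have e : ((m - μ) * U.card) ^ 2 * bprob q {S | ∑ u ∈ U, X u S < μ * U.card} =
    ((m - μ) ^ 2 * U.card * bprob q {S | ∑ u ∈ U, X u S < μ * U.card}) * U.card := by ring
  rw [e] at this
  exact le_of_mul_le_mul_right this hc

/-- The number of elements of the random subset in `T`: first moment. -/
theorem bexp_card_inter (T : Finset ι) :
    bexp q (fun S => ((T ∩ S).card : ℝ)) = ∑ i ∈ T, (q i : ℝ) := by
  have e : (fun S : Finset ι => ((T ∩ S).card : ℝ)) =
      fun S => ∑ i ∈ T, Set.indicator {S : Finset ι | i ∈ S} 1 S := by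
    funext S
    classical
    rw [← Finset.filter_mem_eq_inter, Finset.card_filter]
    push_cast
    exact Finset.sum_congr rfl fun i _ => by simp [Set.indicator_apply]
  rw [e, bexp_sum]
  exact Finset.sum_congr rfl fun i _ => bprob_mem q i

/-- The number of elements of the random subset in `T`: second moment. -/
theorem bexp_card_inter_sq (T : Finset ι) :
    bexp q (fun S => ((T ∩ S).card : ℝ) ^ 2) ≤
      (∑ i ∈ T, (q i : ℝ)) + (∑ i ∈ T, (q i : ℝ)) ^ 2 := by
  have e : (fun S : Finset ι => ((T ∩ S).card : ℝ) ^ 2) =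
      fun S => ∑ i ∈ T, ∑ j ∈ T, Set.indicator {S : Finset ι | {i, j} ⊆ S} 1 S := by
    funext S
    classical
    rw [← Finset.filter_mem_eq_inter, Finset.card_filter]
    push_cast
    rw [sq, Finset.sum_mul_sum]
    refine Finset.sum_congr rfl fun i _ => Finset.sum_congr rfl fun j _ => ?_
    simp only [Set.indicator_apply, Set.mem_ofPred_eq, Finset.insert_subset_iff,
      Finset.singleton_subset_iff, Pi.one_apply]
    split_ifs <;> first | tauto | norm_num
  rw [e, bexp_sum]
  have h : ∀ i ∈ T, bexp q (fun S => ∑ j ∈ T, Set.indicator {S : Finset ι | {i, j} ⊆ S} 1 S) ≤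
      q i + q i * ∑ j ∈ T, (q j : ℝ) := by
    intro i hi
    rw [bexp_sum]
    have h2 : ∀ j ∈ T, bexp q (Set.indicator {S : Finset ι | {i, j} ⊆ S} 1) ≤
        (if j = i then (q i : ℝ) else 0) + q i * q j := by
      intro j _
      rw [← bprob, bprob_subset]
      split_ifs with hij
      · subst hij
        simp only [Finset.pair_eq_singleton, Finset.prod_singleton]
        nlinarith [(q j).2.1]
      · rw [Finset.prod_pair (Ne.symm hij), zero_add]
    refine (Finset.sum_le_sum h2).trans ?_
    rw [Finset.sum_add_distrib, Finset.sum_ite_eq' T i, if_pos hi, Finset.mul_sum]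
  refine (Finset.sum_le_sum h).trans ?_
  rw [Finset.sum_add_distrib, ← Finset.sum_mul, sq]

end BernoulliSubset

section Fibers

variable {ι κ : Type*} [Fintype ι] [DecidableEq ι] [Fintype κ] [DecidableEq κ]

/-- The law of total probability, used to condition on the state of the exploration. -/
theorem bprob_eq_sum_fiber (q : ι → unitInterval) (φ : Finset ι → κ) (E : Set (Finset ι)) :
    bprob q E = ∑ h, bprob q (E ∩ {S | φ S = h}) := by
  simp only [bprob]
  rw [← bexp_sum]
  congr 1
  funext S
  rw [Finset.sum_eq_single_of_mem (φ S) (Finset.mem_univ _)]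
  · classical
    simp [Set.indicator_apply]
  · intro h _ hne
    rw [Set.indicator_of_notMem]
    rintro ⟨-, h2⟩
    exact hne h2.symm

end Fibers

/-! ### Truncated breadth first exploration and its geometric growth. -/

section Exploration

variable {V : Type*} [Fintype V] [DecidableEq V]

/-- The nodes outside `B` that are joined to `u` by an edge in `S`. -/
def freshNeighbors (S : Finset (Sym2 V)) (B : Finset V) (u : V) : Finset V :=
  Finset.univ.filter fun w => w ∉ B ∧ s(u, w) ∈ S

/-- The pairs of `u` and a node outside `B`. -/
def freshPairs (B : Finset V) (u : V) : Finset (Sym2 V) :=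
  Bᶜ.image fun w => s(u, w)

/-- The pairs with an element in `A`. -/
def pairsTouching (A : Finset V) : Finset (Sym2 V) :=
  Finset.univ.filter fun e => ∃ u ∈ A, u ∈ e

/-- The fresh neighbors of `u` in `C`, provided that `u` has fewer than `D` fresh neighbors. -/
def offspring (C : Finset V) (D : ℕ) (S : Finset (Sym2 V)) (B : Finset V) (u : V) : Finset V :=
  if (freshNeighbors S B u).card < D then freshNeighbors S B u ∩ C else ∅

/-- The nodes already explored or discovered, for a state consisting of the explored nodes and
two groups of discovered nodes. -/
def seenNodes (h : Finset V × (Bool → Finset V)) : Finset V := h.1 ∪ h.2 true ∪ h.2 false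

/-- The state of a breadth first exploration from `v` inside `C` after `j` steps: the explored
nodes, and two groups of discovered nodes, which descend from the neighbors of `v` in `K true`
and `K false`. -/
def exploration (C : Finset V) (K : Bool → Finset V) (D : ℕ) (v : V) (S : Finset (Sym2 V)) :
    ℕ → Finset V × (Bool → Finset V)
  | 0 => ({v}, fun g => offspring (K g) D S {v} v)
  | j + 1 =>
    (seenNodes (exploration C K D v S j), fun g =>
      ((exploration C K D v S j).2 g).biUnion
        (offspring C D S (seenNodes (exploration C K D v S j))))

omit [Fintype V] in
theorem group_subset_seenNodes (h : Finset V × (Bool → Finset V)) (g : Bool) :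
    h.2 g ⊆ seenNodes h := by
  intro x hx
  cases g <;> simp [seenNodes, hx]

omit [Fintype V] in
theorem explored_subset_seenNodes (h : Finset V × (Bool → Finset V)) : h.1 ⊆ seenNodes h := by
  intro x hx
  simp [seenNodes, hx]

omit [Fintype V] [DecidableEq V] in
theorem sym2_mk_injective (u : V) : Function.Injective fun w => s(u, w) := by
  intro w w' h
  rcases Sym2.eq_iff.1 h with ⟨-, h⟩ | ⟨h1, h2⟩
  · exact h
  · exact h2.trans h1

theorem card_freshNeighbors (S : Finset (Sym2 V)) (B : Finset V) (u : V) :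
    (freshNeighbors S B u).card = (freshPairs B u ∩ S).card := by
  rw [← Finset.card_image_of_injective _ (sym2_mk_injective u)]
  congr 1
  ext e
  simp only [freshNeighbors, freshPairs, Finset.mem_image, Finset.mem_filter, Finset.mem_univ,
    true_and, Finset.mem_inter, Finset.mem_compl]
  constructor
  · rintro ⟨w, ⟨h1, h2⟩, rfl⟩
    exact ⟨⟨w, h1, rfl⟩, h2⟩
  · rintro ⟨⟨w, h1, rfl⟩, h2⟩
    exact ⟨w, ⟨h1, h2⟩, rfl⟩

theorem card_freshNeighbors_inter (S : Finset (Sym2 V)) (B C : Finset V) (u : V) :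
    (freshNeighbors S B u ∩ C).card = (((C \ B).image fun w => s(u, w)) ∩ S).card := by
  rw [← Finset.card_image_of_injective _ (sym2_mk_injective u)]
  congr 1
  ext e
  simp only [freshNeighbors, Finset.mem_image, Finset.mem_filter, Finset.mem_univ,
    true_and, Finset.mem_inter, Finset.mem_sdiff]
  constructor
  · rintro ⟨w, ⟨⟨h1, h2⟩, h3⟩, rfl⟩
    exact ⟨⟨w, ⟨h3, h1⟩, rfl⟩, h2⟩
  · rintro ⟨⟨w, ⟨h3, h1⟩, rfl⟩, h2⟩
    exact ⟨w, ⟨⟨h1, h2⟩, h3⟩, rfl⟩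

theorem freshNeighbors_congr {S T : Finset (Sym2 V)} {B : Finset V} {u : V}
    (h : ∀ e ∈ freshPairs B u, e ∈ S ↔ e ∈ T) : freshNeighbors S B u = freshNeighbors T B u := by
  ext w
  simp only [freshNeighbors, Finset.mem_filter, Finset.mem_univ, true_and]
  refine and_congr_right fun hw => h _ ?_
  exact Finset.mem_image_of_mem _ (by simpa using hw)

theorem offspring_congr {S T : Finset (Sym2 V)} {C B : Finset V} {D : ℕ} {u : V}
    (h : ∀ e ∈ freshPairs B u, e ∈ S ↔ e ∈ T) : offspring C D S B u = offspring C D T B u := by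
  rw [offspring, offspring, freshNeighbors_congr h]

theorem mem_iff_of_inter_eq {ι : Type*} [DecidableEq ι] {S T I : Finset ι} (h : S ∩ I = T ∩ I)
    {e : ι} (he : e ∈ I) : e ∈ S ↔ e ∈ T := by
  have := congrArg (e ∈ ·) h
  simpa [he] using this

theorem offspring_dependsOn (C B : Finset V) (D : ℕ) (u : V) :
    DependsOnCoords (fun S => offspring C D S B u) (freshPairs B u) :=
  fun _ _ h => offspring_congr fun _ he => mem_iff_of_inter_eq h he

theorem mem_offspring {C : Finset V} {D : ℕ} {S : Finset (Sym2 V)} {B : Finset V} {u w : V} :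
    w ∈ offspring C D S B u ↔
      (freshNeighbors S B u).card < D ∧ w ∉ B ∧ s(u, w) ∈ S ∧ w ∈ C := by
  rw [offspring]
  split_ifs with h
  · simp only [Finset.mem_inter, h, true_and]
    simp [freshNeighbors, and_assoc]
  · simp [h]

theorem card_offspring_le (C : Finset V) (D : ℕ) (S : Finset (Sym2 V)) (B : Finset V) (u : V) :
    (offspring C D S B u).card ≤ D := by
  rw [offspring]
  split_ifs with h
  · exact (Finset.card_le_card Finset.inter_subset_left).trans h.le
  · simp

/-- A fresh pair joins its center to a node outside `B`. A pair fresh for both `u` and `w` would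
have `u` as its outer end, although `u ∈ B`. This is the source of the independence of offspring of
distinct nodes. -/
theorem freshPairs_disjoint {B : Finset V} {u w : V} (hu : u ∈ B) (huw : u ≠ w) :
    Disjoint (freshPairs B u) (freshPairs B w) := by
  rw [Finset.disjoint_left]
  intro e he he'
  simp only [freshPairs, Finset.mem_image, Finset.mem_compl] at he he'
  obtain ⟨x, hx, rfl⟩ := he
  obtain ⟨y, hy, h⟩ := he'
  rw [Sym2.eq_iff] at h
  rcases h with ⟨h, -⟩ | ⟨-, h⟩
  · exact huw h.symm
  · exact hy (h ▸ hu)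

/-- Truncation at `D` is cheap: with `N` the number of fresh neighbors, it loses at most `N` nodes
and only if `N ≥ D`, so at most `N ^ 2 / D`. The second moment of `N` is at most `κ + κ ^ 2`. -/
theorem bexp_card_offspring_ge (q : Sym2 V → unitInterval) {κ : ℝ} {C B : Finset V} {D : ℕ}
    (hD : 0 < D) {u : V} (hκ : ∑ w, (q s(u, w) : ℝ) ≤ κ) :
    (∑ w ∈ C \ B, (q s(u, w) : ℝ)) - (κ + κ ^ 2) / D ≤
      bexp q (fun S => ((offspring C D S B u).card : ℝ)) ∧
    bexp q (fun S => ((offspring C D S B u).card : ℝ) ^ 2) ≤ κ + κ ^ 2 := by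
  have hD' : (0 : ℝ) < D := by exact_mod_cast hD
  have hsum : ∑ e ∈ freshPairs B u, (q e : ℝ) ≤ κ := by
    rw [freshPairs, Finset.sum_image fun _ _ _ _ h => sym2_mk_injective u h]
    exact (Finset.sum_le_univ_sum_of_nonneg fun w => (q s(u, w)).2.1).trans hκ
  have h0 : 0 ≤ ∑ e ∈ freshPairs B u, (q e : ℝ) := Finset.sum_nonneg fun e _ => (q e).2.1
  have hsq : bexp q (fun S => ((freshNeighbors S B u).card : ℝ) ^ 2) ≤ κ + κ ^ 2 := by
    simp only [card_freshNeighbors]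
    refine (bexp_card_inter_sq q _).trans ?_
    gcongr
  refine ⟨?_, ?_⟩
  · have hZ : bexp q (fun S => ((freshNeighbors S B u ∩ C).card : ℝ)) =
        ∑ w ∈ C \ B, (q s(u, w) : ℝ) := by
      simp only [card_freshNeighbors_inter]
      rw [bexp_card_inter, Finset.sum_image fun _ _ _ _ h => sym2_mk_injective u h]
    have key := bexp_mono q (f := fun S => ((freshNeighbors S B u ∩ C).card : ℝ) -
        (1 / D) * ((freshNeighbors S B u).card : ℝ) ^ 2)
      (g := fun S => ((offspring C D S B u).card : ℝ)) (by
        intro S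
        simp only [offspring]
        split_ifs with h
        · have : (0 : ℝ) ≤ 1 / D * ((freshNeighbors S B u).card : ℝ) ^ 2 := by positivity
          linarith
        · push Not at h
          have h1 : ((freshNeighbors S B u ∩ C).card : ℝ) ≤ (freshNeighbors S B u).card := by
            exact_mod_cast Finset.card_le_card Finset.inter_subset_left
          have h2 : (D : ℝ) ≤ (freshNeighbors S B u).card := by exact_mod_cast h
          have h3 : ((freshNeighbors S B u).card : ℝ) ≤
              1 / D * ((freshNeighbors S B u).card : ℝ) ^ 2 := by
            rw [one_div, ← div_eq_inv_mul, le_div_iff₀ hD', sq]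
            gcongr
          simp only [Finset.card_empty, Nat.cast_zero]
          linarith)
    rw [bexp_sub, bexp_const_mul, hZ] at key
    have : 1 / D * bexp q (fun S => ((freshNeighbors S B u).card : ℝ) ^ 2) ≤ (κ + κ ^ 2) / D := by
      rw [one_div, div_eq_inv_mul]
      gcongr
    linarith
  · refine (bexp_mono q fun S => ?_).trans hsq
    have : (offspring C D S B u).card ≤ (freshNeighbors S B u).card := by
      rw [offspring]
      split_ifs
      · exact Finset.card_le_card Finset.inter_subset_left
      · simp
    gcongr

/-- In one step of the exploration a group grows by the factor `μ`, except with a probability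
inversely proportional to its size. -/
theorem bprob_offspring_lt (q : Sym2 V → unitInterval) {κ m μ : ℝ} {C B U : Finset V} {D : ℕ}
    (hD : 0 < D) (hκ0 : 0 ≤ κ) (hκ : ∀ u ∈ C, ∑ w, (q s(u, w) : ℝ) ≤ κ) (hUC : U ⊆ C) (hUB : U ⊆ B)
    (hm : ∀ u ∈ C, m + (κ + κ ^ 2) / D ≤ ∑ w ∈ C \ B, (q s(u, w) : ℝ)) (hμ : μ < m) :
    (m - μ) ^ 2 * U.card *
      bprob q {S | ∑ u ∈ U, ((offspring C D S B u).card : ℝ) < μ * U.card} ≤ κ + κ ^ 2 := by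
  refine bprob_sum_lt q U (fun u S => ((offspring C D S B u).card : ℝ)) (freshPairs B) ?_ ?_ hμ
    (by positivity) ?_ ?_
  · intro u _ S T h
    simp only [offspring_dependsOn C B D u S T h]
  · intro u hu w _ huw
    exact freshPairs_disjoint (hUB hu) huw
  · intro u hu
    have := (bexp_card_offspring_ge q (C := C) (B := B) hD (hκ u (hUC hu))).1
    linarith [hm u (hUC hu)]
  · intro u hu
    exact (bexp_card_offspring_ge q (C := C) (B := B) hD (hκ u (hUC hu))).2

variable {C : Finset V} {K : Bool → Finset V} {D : ℕ} {v : V}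

theorem exploration_group_subset (hK : ∀ g, K g ⊆ C) (S : Finset (Sym2 V)) (j : ℕ) (g : Bool) :
    (exploration C K D v S j).2 g ⊆ C := by
  intro x hx
  cases j with
  | zero => exact hK g (mem_offspring.1 hx).2.2.2
  | succ j =>
    obtain ⟨u, _, hu⟩ := Finset.mem_biUnion.1 hx
    exact (mem_offspring.1 hu).2.2.2

theorem exploration_group_notMem (S : Finset (Sym2 V)) (j : ℕ) (g : Bool) {x : V}
    (hx : x ∈ (exploration C K D v S j).2 g) : x ∉ (exploration C K D v S j).1 := by
  cases j with
  | zero => exact (mem_offspring.1 hx).2.1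
  | succ j =>
    obtain ⟨u, _, hu⟩ := Finset.mem_biUnion.1 hx
    exact (mem_offspring.1 hu).2.1

/-- Because of the truncation this bound does not involve the number of nodes of the graph, so in a
large class removing the seen nodes hardly changes the expected number of fresh neighbors. -/
theorem card_seenNodes_exploration (S : Finset (Sym2 V)) (j : ℕ) :
    (seenNodes (exploration C K D v S j)).card ≤ (1 + 2 * D) ^ (j + 1) := by
  have hle : ∀ h : Finset V × (Bool → Finset V),
      (seenNodes h).card ≤ h.1.card + (h.2 true).card + (h.2 false).card := fun h =>
    (Finset.card_union_le _ _).trans (Nat.add_le_add_right (Finset.card_union_le _ _) _)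
  induction j with
  | zero =>
    refine (hle _).trans ?_
    have h1 := card_offspring_le (K true) D S {v} v
    have h2 := card_offspring_le (K false) D S {v} v
    simp only [exploration, Finset.card_singleton, pow_one, zero_add]
    omega
  | succ j ih =>
    refine (hle _).trans ?_
    have h : ∀ g, ((exploration C K D v S (j + 1)).2 g).card ≤
        (seenNodes (exploration C K D v S j)).card * D := fun g =>
      (Finset.card_biUnion_le_card_mul _ _ D fun u _ => card_offspring_le _ _ _ _ _).trans
        (Nat.mul_le_mul_right _ (Finset.card_le_card (group_subset_seenNodes _ g)))
    have h1 := h true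
    have h2 := h false
    have h3 : (exploration C K D v S (j + 1)).1.card =
      (seenNodes (exploration C K D v S j)).card := rfl
    rw [pow_succ]
    nlinarith

/-- The history of the exploration depends only on the pairs that touch explored nodes. -/
theorem exploration_congr {S T : Finset (Sym2 V)} (j : ℕ)
    (h : ∀ e ∈ pairsTouching (exploration C K D v S j).1, e ∈ S ↔ e ∈ T) :
    ∀ i ≤ j, exploration C K D v T i = exploration C K D v S i := by
  have fresh_sub : ∀ {A B : Finset V} {u : V}, u ∈ A → freshPairs B u ⊆ pairsTouching A := by
    intro A B u hu e he
    simp only [freshPairs, Finset.mem_image, Finset.mem_compl] at he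
    obtain ⟨w, _, rfl⟩ := he
    simp only [pairsTouching, Finset.mem_filter, Finset.mem_univ, true_and]
    exact ⟨u, hu, Sym2.mem_mk_left _ _⟩
  induction j with
  | zero =>
    intro i hi
    obtain rfl : i = 0 := by omega
    simp only [exploration]
    congr 1
    funext g
    exact offspring_congr fun e he =>
      (h e (fresh_sub (by simp [exploration]) he)).symm
  | succ j ih =>
    have hsub : pairsTouching (exploration C K D v S j).1 ⊆
        pairsTouching (exploration C K D v S (j + 1)).1 := by
      intro e he
      simp only [pairsTouching, Finset.mem_filter, Finset.mem_univ, true_and] at he ⊢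
      obtain ⟨u, hu, hue⟩ := he
      exact ⟨u, explored_subset_seenNodes _ hu, hue⟩
    have ih' := ih fun e he => h e (hsub he)
    intro i hi
    rcases Nat.lt_or_ge j i with hji | hij
    · obtain rfl : i = j + 1 := by omega
      simp only [exploration]
      rw [ih' j le_rfl]
      congr 1
      funext g
      refine Finset.biUnion_congr rfl fun u hu => ?_
      exact offspring_congr fun e he =>
        (h e (fresh_sub (group_subset_seenNodes _ g hu) he)).symm
    · exact ih' i hij

/-- Up to step `j` both groups of the exploration are at least as large as `z * μ ^ i`. -/
def growsUntil (C : Finset V) (K : Bool → Finset V) (D : ℕ) (v : V) (z μ : ℝ) (j : ℕ) :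
    Set (Finset (Sym2 V)) :=
  {S | ∀ i ≤ j, ∀ g, z * μ ^ i ≤ ((exploration C K D v S i).2 g).card}

/-- For one of the groups of the state `h`, the total number of offspring is too small. -/
def Stalls (C : Finset V) (D : ℕ) (μ : ℝ) (h : Finset V × (Bool → Finset V))
    (S : Finset (Sym2 V)) : Prop :=
  ∃ g, ∑ u ∈ h.2 g, ((offspring C D S (seenNodes h) u).card : ℝ) < μ * (h.2 g).card

/-- Condition on the state `h` after `j` steps. The history is decided by pairs touching explored
nodes, a stall by fresh pairs of discovered nodes, and these are disjoint. Each group of `h` has at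
least `z * μ ^ j` nodes, the denominator in Chebyshev's inequality; the factor `2` counts the
groups. -/
theorem bprob_stalls_le (q : Sym2 V → unitInterval) {κ m μ z : ℝ} {M : ℕ} (j : ℕ)
    (hM : (1 + 2 * D) ^ (j + 1) ≤ M) (hD : 0 < D) (hκ0 : 0 ≤ κ) (hz : 0 < z) (hμ0 : 0 < μ)
    (hκ : ∀ u ∈ C, ∑ w, (q s(u, w) : ℝ) ≤ κ) (hK : ∀ g, K g ⊆ C)
    (hm : ∀ u ∈ C, ∀ B : Finset V, B.card ≤ M →
      m + (κ + κ ^ 2) / D ≤ ∑ w ∈ C \ B, (q s(u, w) : ℝ)) (hμ : μ < m) :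
    bprob q (growsUntil C K D v z μ j ∩
        {S | Stalls C D μ (exploration C K D v S j) S}) ≤
      2 * (κ + κ ^ 2) / ((m - μ) ^ 2 * z) * (1 / μ) ^ j *
        bprob q (growsUntil C K D v z μ j) := by
  rw [bprob_eq_sum_fiber q (fun S => exploration C K D v S j) (growsUntil C K D v z μ j),
    bprob_eq_sum_fiber q (fun S => exploration C K D v S j), Finset.mul_sum]
  refine Finset.sum_le_sum fun h _ => ?_
  -- Only reachable states matter. A representative `S₀` of the fiber supplies the structural facts
  -- about `h`: its groups lie in `C`, avoid the explored nodes and are large enough.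
  rcases Set.eq_empty_or_nonempty
    (growsUntil C K D v z μ j ∩ {S | exploration C K D v S j = h}) with hemp | ⟨S₀, hS₀, hh⟩
  · have hle : bprob q (growsUntil C K D v z μ j ∩
        {S | Stalls C D μ (exploration C K D v S j) S} ∩
        {S | exploration C K D v S j = h}) ≤ bprob q ∅ := by
      refine bprob_mono q ?_
      rw [← hemp]
      exact fun S hS => ⟨hS.1.1, hS.2⟩
    have h0 : bprob q ∅ = 0 := by simp [bprob, bexp]
    rw [h0] at hle
    refine hle.trans (mul_nonneg (by positivity) (bprob_nonneg q _))
  obtain rfl : exploration C K D v S₀ j = h := hh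
  set h := exploration C K D v S₀ j with hh
  have hcard : (seenNodes h).card ≤ M := (card_seenNodes_exploration S₀ j).trans hM
  have hz' : ∀ g, z * μ ^ j ≤ ((h.2 g).card : ℝ) := fun g => hS₀ j le_rfl g
  have hgap : 0 < m - μ := by linarith
  have hstall : bprob q {S | Stalls C D μ h S} ≤
      2 * (κ + κ ^ 2) / ((m - μ) ^ 2 * z) * (1 / μ) ^ j := by
    have hg : ∀ g, bprob q {S | ∑ u ∈ h.2 g, ((offspring C D S (seenNodes h) u).card : ℝ) <
        μ * (h.2 g).card} ≤ (κ + κ ^ 2) / ((m - μ) ^ 2 * (z * μ ^ j)) := by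
      intro g
      have := bprob_offspring_lt q (U := h.2 g) (B := seenNodes h) hD hκ0 hκ
        (exploration_group_subset hK S₀ j g) (group_subset_seenNodes h g)
        (fun u hu => hm u hu _ hcard) hμ
      rw [le_div_iff₀ (by positivity), mul_comm]
      refine le_trans ?_ this
      have hb := bprob_nonneg q {S | ∑ u ∈ h.2 g, ((offspring C D S (seenNodes h) u).card : ℝ) <
        μ * (h.2 g).card}
      gcongr
      exact hz' g
    have hsub : {S | Stalls C D μ h S} ⊆
        {S | ∑ u ∈ h.2 true, ((offspring C D S (seenNodes h) u).card : ℝ) <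
          μ * (h.2 true).card} ∪
        {S | ∑ u ∈ h.2 false, ((offspring C D S (seenNodes h) u).card : ℝ) <
          μ * (h.2 false).card} := by
      rintro S ⟨g, hg⟩
      cases g
      · exact Or.inr hg
      · exact Or.inl hg
    have := ((bprob_mono q hsub).trans (bprob_union_le q _ _)).trans
      (add_le_add (hg true) (hg false))
    refine this.trans (le_of_eq ?_)
    field_simp
    rw [one_div, inv_pow]
    field_simp
    ring
  have hdis : Disjoint (pairsTouching h.1)
      ((h.2 true ∪ h.2 false).biUnion (freshPairs (seenNodes h))) := by
    rw [Finset.disjoint_left]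
    intro e he he'
    simp only [pairsTouching, Finset.mem_filter, Finset.mem_univ, true_and] at he
    obtain ⟨u, hu, hue⟩ := he
    simp only [Finset.mem_biUnion, Finset.mem_union, freshPairs, Finset.mem_image,
      Finset.mem_compl] at he'
    obtain ⟨x, hx, w, hw, rfl⟩ := he'
    rw [Sym2.mem_iff] at hue
    rcases hue with rfl | rfl
    · rcases hx with hx | hx
      · exact exploration_group_notMem S₀ j true hx hu
      · exact exploration_group_notMem S₀ j false hx hu
    · exact hw (explored_subset_seenNodes h hu)
  have hind := bprob_inter_of_disjoint q hdis
    (E := growsUntil C K D v z μ j ∩ {S | exploration C K D v S j = h})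
    (F := {S | Stalls C D μ h S}) (by
      have aux : ∀ S T : Finset (Sym2 V), S ∩ pairsTouching h.1 = T ∩ pairsTouching h.1 →
          S ∈ growsUntil C K D v z μ j ∩ {S | exploration C K D v S j = h} →
          T ∈ growsUntil C K D v z μ j ∩ {S | exploration C K D v S j = h} := by
        rintro S T hST ⟨h1, h2⟩
        -- The agreement at all steps `i ≤ j` is needed, since `growsUntil` refers to every earlier
        -- generation.
        have hc := exploration_congr (C := C) (K := K) (D := D) (v := v) (S := S) (T := T) j
          (fun e he => mem_iff_of_inter_eq hST (by rw [← h2]; exact he))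
        refine ⟨fun i hi g => ?_, ?_⟩
        · rw [hc i hi]
          exact h1 i hi g
        · exact (hc j le_rfl).trans h2
      intro S T hST
      exact propext ⟨aux S T hST, aux T S hST.symm⟩) (by
      have aux : ∀ S T : Finset (Sym2 V),
          S ∩ (h.2 true ∪ h.2 false).biUnion (freshPairs (seenNodes h)) =
          T ∩ (h.2 true ∪ h.2 false).biUnion (freshPairs (seenNodes h)) →
          Stalls C D μ h S → Stalls C D μ h T := by
        rintro S T hST ⟨g, hg⟩
        refine ⟨g, lt_of_eq_of_lt (Finset.sum_congr rfl fun u hu => ?_) hg⟩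
        rw [offspring_congr (S := S) (T := T) fun e he => mem_iff_of_inter_eq hST
          (Finset.mem_biUnion.2 ⟨u, by cases g <;> simp [hu], he⟩)]
      intro S T hST
      exact propext ⟨aux S T hST, aux T S hST.symm⟩)
  calc bprob q (growsUntil C K D v z μ j ∩
        {S | Stalls C D μ (exploration C K D v S j) S} ∩
        {S | exploration C K D v S j = h}) ≤
      bprob q (growsUntil C K D v z μ j ∩ {S | exploration C K D v S j = h} ∩
        {S | Stalls C D μ h S}) := by
        refine bprob_mono q ?_
        intro S hS
        have h3 : exploration C K D v S j = h := hS.2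
        have h2 : Stalls C D μ (exploration C K D v S j) S := hS.1.2
        exact ⟨⟨hS.1.1, h3⟩, h3 ▸ h2⟩
    _ = _ := hind
    _ ≤ _ := by
        rw [mul_comm]
        exact mul_le_mul_of_nonneg_right hstall (bprob_nonneg q _)

theorem growsUntil_anti {z μ : ℝ} {i j : ℕ} (hij : i ≤ j) :
    growsUntil C K D v z μ j ⊆ growsUntil C K D v z μ i :=
  fun _ h l hl => h l (hl.trans hij)

/-- If, off the event `Z`, the groups have as many discovered nodes as there are offspring, then
both groups grow until step `r` with at least about half the probability of a good start. -/
theorem bprob_growsUntil_ge (q : Sym2 V → unitInterval) {κ m μ z : ℝ} {M : ℕ} (r : ℕ)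
    (Z : Set (Finset (Sym2 V)))
    (hM : (1 + 2 * D) ^ (r + 1) ≤ M) (hD : 0 < D) (hκ0 : 0 ≤ κ) (hz : 0 < z) (hμ1 : 1 < μ)
    (hκ : ∀ u ∈ C, ∑ w, (q s(u, w) : ℝ) ≤ κ) (hK : ∀ g, K g ⊆ C)
    (hm : ∀ u ∈ C, ∀ B : Finset V, B.card ≤ M →
      m + (κ + κ ^ 2) / D ≤ ∑ w ∈ C \ B, (q s(u, w) : ℝ)) (hμ : μ < m)
    (hzl : 4 * (κ + κ ^ 2) * μ / ((m - μ) ^ 2 * (μ - 1)) ≤ z)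
    (hZ : ∀ S ∉ Z, ∀ j < r, ∀ g,
      ((exploration C K D v S (j + 1)).2 g).card =
        ∑ u ∈ (exploration C K D v S j).2 g,
          (offspring C D S (seenNodes (exploration C K D v S j)) u).card) :
    bprob q (growsUntil C K D v z μ 0) / 2 - bprob q Z ≤
      bprob q (growsUntil C K D v z μ r \ Z) := by
  have hμ0 : 0 < μ := by linarith
  have hgap : 0 < m - μ := by linarith
  -- After a good start, either the growth continues to step `r` off `Z`, or `Z` occurs, or some
  -- step `j < r` stalls while the growth up to `j` was intact.
  have hcover : growsUntil C K D v z μ 0 ⊆ (growsUntil C K D v z μ r \ Z) ∪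
      (Z ∪ ⋃ j ∈ Finset.range r, growsUntil C K D v z μ j ∩
        {S | Stalls C D μ (exploration C K D v S j) S}) := by
    intro S hS
    by_contra hcon
    simp only [Set.mem_union, Set.mem_sdiff, Set.mem_iUnion, Finset.mem_range, not_or, not_and,
      not_not, not_exists, Set.mem_inter_iff, Set.mem_ofPred_eq] at hcon
    obtain ⟨h1, h2, h3⟩ := hcon
    have hall : ∀ j ≤ r, S ∈ growsUntil C K D v z μ j := by
      intro j
      induction j with
      | zero => exact fun _ => hS
      | succ j ih =>
        intro hj
        have hgj := ih (by omega)
        have hns := h3 j (by omega) hgj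
        simp only [Stalls, not_exists, not_lt] at hns
        intro i hi g
        rcases Nat.lt_or_ge j i with hji | hij
        · obtain rfl : i = j + 1 := by omega
          rw [hZ S h2 j (by omega) g]
          push_cast
          refine le_trans ?_ (hns g)
          have := hgj j le_rfl g
          calc z * μ ^ (j + 1) = μ * (z * μ ^ j) := by ring
            _ ≤ _ := by gcongr
        · exact hgj i hij g
    exact h2 (h1 (hall r le_rfl))
  have h1 := (bprob_mono q hcover).trans ((bprob_union_le q _ _).trans
    (add_le_add le_rfl ((bprob_union_le q _ _).trans
      (add_le_add le_rfl (bprob_iUnion_le q _ _)))))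
  set c := 2 * (κ + κ ^ 2) / ((m - μ) ^ 2 * z) with hc
  have hc0 : 0 ≤ c := by positivity
  have h2 : ∑ j ∈ Finset.range r, bprob q (growsUntil C K D v z μ j ∩
      {S | Stalls C D μ (exploration C K D v S j) S}) ≤
      (1 / 2) * bprob q (growsUntil C K D v z μ 0) := by
    have hj : ∀ j ∈ Finset.range r, bprob q (growsUntil C K D v z μ j ∩
        {S | Stalls C D μ (exploration C K D v S j) S}) ≤
        c * (1 / μ) ^ j * bprob q (growsUntil C K D v z μ 0) := by
      intro j hj
      have hjr := Finset.mem_range.1 hj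
      refine (bprob_stalls_le q (M := M) j
        ((Nat.pow_le_pow_right (by omega) (by omega)).trans hM) hD hκ0 hz hμ0 hκ hK hm hμ).trans ?_
      have : 0 ≤ c * (1 / μ) ^ j := by positivity
      -- Bounding by the probability of the start makes the total loss a fraction of that
      -- probability, however small it is.
      exact mul_le_mul_of_nonneg_left (bprob_mono q (growsUntil_anti (Nat.zero_le j))) this
    refine (Finset.sum_le_sum hj).trans ?_
    rw [← Finset.sum_mul, ← Finset.mul_sum]
    refine mul_le_mul_of_nonneg_right ?_ (bprob_nonneg q _)
    have hgeo : ∑ j ∈ Finset.range r, (1 / μ) ^ j ≤ μ / (μ - 1) := by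
      have hlt : 1 / μ < 1 := by rw [div_lt_one hμ0]; exact hμ1
      have hs := (summable_geometric_of_lt_one (by positivity) hlt).sum_le_tsum
        (Finset.range r) (fun j _ => by positivity)
      rw [tsum_geometric_of_lt_one (by positivity) hlt] at hs
      refine hs.trans (le_of_eq ?_)
      have : μ - 1 ≠ 0 := by linarith
      field_simp
    -- The lower bound `hzl` on `z` is exactly what makes `c` times the geometric series at most `1
    -- / 2`.
    have hμ1' : 0 < μ - 1 := by linarith
    calc c * ∑ j ∈ Finset.range r, (1 / μ) ^ j ≤ c * (μ / (μ - 1)) := by gcongr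
      _ ≤ 1 / 2 := by
        rw [div_le_iff₀ (by positivity)] at hzl
        rw [hc, div_mul_div_comm, div_le_div_iff₀ (by positivity) (by norm_num)]
        nlinarith
  linarith

end Exploration

/-! ### The neighbors of the root. -/

section FirstStep

theorem exists_disjoint_family {V : Type*} [DecidableEq V] (W : Finset V) (m t : ℕ)
    (h : m * t ≤ W.card) :
    ∃ B : Fin m → Finset V, (∀ i, B i ⊆ W) ∧ (∀ i, (B i).card = t) ∧
      ∀ i j, i ≠ j → Disjoint (B i) (B j) := by
  induction m generalizing W with
  | zero => exact ⟨fun _ => ∅, fun i => i.elim0, fun i => i.elim0, fun i => i.elim0⟩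
  | succ m ih =>
    obtain ⟨A, hAW, hA⟩ := Finset.exists_subset_card_eq
      (show t ≤ W.card from le_trans (by nlinarith) h)
    obtain ⟨B, h1, h2, h3⟩ := ih (W \ A) (by
      rw [Finset.card_sdiff_of_subset hAW, hA]
      rw [Nat.add_mul, one_mul] at h
      omega)
    have hd : ∀ i, Disjoint A (B i) := fun i =>
      Finset.disjoint_of_subset_right (h1 i) Finset.disjoint_sdiff
    refine ⟨Fin.cons A B, ?_, ?_, ?_⟩
    · intro i
      refine Fin.cases hAW (fun i => ?_) i
      exact (h1 i).trans Finset.sdiff_subset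
    · intro i
      refine Fin.cases hA (fun i => ?_) i
      exact h2 i
    · intro i j
      refine Fin.cases ?_ (fun i => ?_) i
      · refine Fin.cases (fun h => absurd rfl h) (fun j _ => ?_) j
        exact hd j
      · refine Fin.cases (fun _ => (hd i).symm) (fun j hij => ?_) j
        exact h3 i j fun h => hij (congrArg Fin.succ h)

theorem bprob_biInter_of_disjoint {ι κ : Type*} [Fintype ι] [DecidableEq ι] [DecidableEq κ]
    (q : ι → unitInterval) (T : Finset κ) (I : κ → Finset ι) (E : κ → Set (Finset ι))
    (hE : ∀ k, DependsOnCoords (· ∈ E k) (I k)) (hI : ∀ k l, k ≠ l → Disjoint (I k) (I l)) :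
    bprob q {S | ∀ k ∈ T, S ∈ E k} = ∏ k ∈ T, bprob q (E k) := by
  induction T using Finset.induction_on with
  | empty =>
    simp only [Finset.notMem_empty, IsEmpty.forall_iff, implies_true, Set.ofPred_true, bprob,
      Set.indicator_univ, Finset.prod_empty]
    exact bexp_const q 1
  | insert k T hk ih =>
    have e : {S | ∀ l ∈ insert k T, S ∈ E l} = E k ∩ {S | ∀ l ∈ T, S ∈ E l} := by
      ext S
      simp
    rw [e, bprob_inter_of_disjoint q (I := I k) (J := T.biUnion I) _ (hE k), ih,
      Finset.prod_insert hk]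
    · intro S S' h
      refine propext (forall₂_congr fun l hl => ?_)
      exact iff_of_eq ((hE l).mono (Finset.subset_biUnion_of_mem I hl) S S' h)
    · rw [Finset.disjoint_biUnion_right]
      exact fun l hl => hI k l fun h => hk (h ▸ hl)

variable {V : Type*} [Fintype V] [DecidableEq V]
  {C : Finset V} {K : Bool → Finset V} {D : ℕ} {v : V}

/-- The `2 * z` disjoint blocks contain a neighbor of `v` independently, each with probability at
least `1 - exp (-ξ)`. If all do, both groups start with `z` distinct nodes, unless `v` itself is cut
off for its degree, which costs `κ / D` by Markov's inequality. -/
theorem bprob_growsUntil_zero_ge (q : Sym2 V → unitInterval) {κ ξ μ : ℝ} {z : ℕ} (hD : 0 < D)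
    (B : Bool × Fin z → Finset V) (hBK : ∀ k, B k ⊆ K k.1) (hv : ∀ k, v ∉ B k)
    (hB : ∀ k l, k ≠ l → Disjoint (B k) (B l)) (hξ0 : 0 ≤ ξ)
    (hξ : ∀ k, ξ ≤ ∑ w ∈ B k, (q s(v, w) : ℝ)) (hκ : ∑ w, (q s(v, w) : ℝ) ≤ κ) :
    (1 - Real.exp (-ξ)) ^ (2 * z) - κ / D ≤ bprob q (growsUntil C K D v z μ 0) := by
  have hD' : (0 : ℝ) < D := by exact_mod_cast hD
  set I : Bool × Fin z → Finset (Sym2 V) := fun k => (B k).image fun w => s(v, w) with hI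
  have hhit : ∀ k, 1 - Real.exp (-ξ) ≤ bprob q {S | Disjoint (I k) S}ᶜ := by
    intro k
    rw [bprob_compl, bprob_disjoint]
    have : ∏ e ∈ I k, (1 - (q e : ℝ)) ≤ Real.exp (-ξ) := by
      calc ∏ e ∈ I k, (1 - (q e : ℝ)) ≤ ∏ e ∈ I k, Real.exp (-(q e : ℝ)) := by
            refine Finset.prod_le_prod (fun e _ => sub_nonneg.2 (q e).2.2) fun e _ => ?_
            have := Real.add_one_le_exp (-(q e : ℝ))
            linarith
        _ = Real.exp (-∑ e ∈ I k, (q e : ℝ)) := by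
            rw [← Real.exp_sum, Finset.sum_neg_distrib]
        _ ≤ Real.exp (-ξ) := by
            rw [hI, Finset.sum_image fun _ _ _ _ h => sym2_mk_injective v h]
            exact Real.exp_le_exp.2 (neg_le_neg (hξ k))
    linarith
  have h1 : (1 - Real.exp (-ξ)) ^ (2 * z) ≤
      bprob q {S | ∀ k ∈ (Finset.univ : Finset (Bool × Fin z)), S ∈ {S | Disjoint (I k) S}ᶜ} := by
    rw [bprob_biInter_of_disjoint q Finset.univ I (fun k => {S | Disjoint (I k) S}ᶜ)]
    · calc (1 - Real.exp (-ξ)) ^ (2 * z) =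
          ∏ _k : Bool × Fin z, (1 - Real.exp (-ξ)) := by simp
        _ ≤ _ := Finset.prod_le_prod (fun _ _ => by
            have : Real.exp (-ξ) ≤ 1 := Real.exp_le_one_iff.2 (by linarith)
            linarith) fun k _ => hhit k
    · intro k S T h
      simp only [Set.mem_compl_iff, Set.mem_ofPred_eq, Finset.disjoint_iff_inter_eq_empty]
      rw [Finset.inter_comm, h, Finset.inter_comm]
    · intro k l hkl
      have := hB k l hkl
      rw [Finset.disjoint_left] at this ⊢
      intro e he he'
      obtain ⟨w, hw, rfl⟩ := Finset.mem_image.1 he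
      obtain ⟨w', hw', h⟩ := Finset.mem_image.1 he'
      rw [sym2_mk_injective v h] at hw'
      exact this hw hw'
  have h2 : D * bprob q {S | (D : ℝ) ≤ (freshNeighbors S {v} v).card} ≤ κ := by
    refine (bprob_mul_le q (f := fun S => ((freshNeighbors S {v} v).card : ℝ))
      (fun S => Nat.cast_nonneg _) fun S hS => hS).trans ?_
    simp only [card_freshNeighbors]
    rw [bexp_card_inter, freshPairs, Finset.sum_image fun _ _ _ _ h => sym2_mk_injective v h]
    exact (Finset.sum_le_univ_sum_of_nonneg fun w => (q s(v, w)).2.1).trans hκ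
  have h3 : bprob q {S | (D : ℝ) ≤ (freshNeighbors S {v} v).card} ≤ κ / D := by
    rw [le_div_iff₀ hD', mul_comm]
    exact h2
  have h4 : {S | ∀ k ∈ (Finset.univ : Finset (Bool × Fin z)), S ∈ {S | Disjoint (I k) S}ᶜ} ⊆
      growsUntil C K D v z μ 0 ∪ {S | (D : ℝ) ≤ (freshNeighbors S {v} v).card} := by
    intro S hS
    by_cases hdeg : (freshNeighbors S {v} v).card < D
    swap
    · exact Or.inr (by exact_mod_cast not_lt.1 hdeg)
    left
    intro i hi g
    obtain rfl : i = 0 := by omega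
    have hw : ∀ i : Fin z, ∃ w ∈ B (g, i), s(v, w) ∈ S := by
      intro i
      have := hS (g, i) (Finset.mem_univ _)
      simp only [Set.mem_compl_iff, Set.mem_ofPred_eq, Finset.not_disjoint_iff, hI,
        Finset.mem_image] at this
      obtain ⟨_, ⟨w, hw, rfl⟩, hwS⟩ := this
      exact ⟨w, hw, hwS⟩
    choose w hwB hwS using hw
    have hinj : Function.Injective w := by
      intro i j hij
      by_contra hne
      have := Finset.disjoint_left.1 (hB (g, i) (g, j) fun h => hne (Prod.ext_iff.1 h).2) (hwB i)
      exact this (hij ▸ hwB j)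
    have hcard : z ≤ (offspring (K g) D S {v} v).card := by
      have := Finset.card_le_card_of_injOn (s := Finset.univ) (t := offspring (K g) D S {v} v) w
        (fun i _ => by
          rw [Finset.mem_coe, mem_offspring]
          refine ⟨hdeg, ?_, hwS i, hBK (g, i) (hwB i)⟩
          rw [Finset.mem_singleton]
          rintro rfl
          exact hv _ (hwB i)) hinj.injOn
      simpa using this
    simp only [pow_zero, mul_one, exploration]
    exact_mod_cast hcard
  have h5 := (bprob_mono q h4).trans (bprob_union_le q _ _)
  linarith

end FirstStep

/-! ### Local uniqueness of paths, ancestors and candidate labels. -/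

section UniquePaths

open SimpleGraph

variable {V : Type*}

/-- Paths of length at most `L` from `v` are determined by their other endpoint. -/
def UniquePaths (G : SimpleGraph V) (v : V) (L : ℕ) : Prop :=
  ∀ (x : V) (P Q : G.Walk v x), P.IsPath → Q.IsPath → P.length ≤ L → Q.length ≤ L → P = Q

variable {G : SimpleGraph V} {v : V} {L : ℕ}

theorem isPath_of_length_eq_edist {u w : V} (P : G.Walk u w)
    (h : (P.length : ℕ∞) = G.edist u w) : P.IsPath := by
  refine P.isPath_of_length_eq_dist ?_
  rw [SimpleGraph.dist, ← h]
  rfl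

theorem exists_path_of_edist_le {u w : V} {r : ℕ} (h : G.edist u w ≤ r) :
    ∃ P : G.Walk u w, P.IsPath ∧ P.length ≤ r := by
  obtain ⟨P, hP⟩ := exists_walk_of_edist_ne_top (ne_top_of_le_ne_top (ENat.natCast_ne_top r) h)
  refine ⟨P, isPath_of_length_eq_edist P hP, ?_⟩
  rw [← hP] at h
  exact_mod_cast h

/-- A node at most as far from the root as `u` can only be adjacent to `u` as its parent. -/
theorem UniquePaths.eq_penultimate (hG : UniquePaths G v L) {u z : V} {P : G.Walk v u}
    (hP : P.IsPath) (hPL : P.length + 1 ≤ L) (hz : G.Adj z u) {Q : G.Walk v z} (hQ : Q.IsPath)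
    (hQP : Q.length ≤ P.length) : z = P.penultimate := by
  classical
  by_cases hu : u ∈ Q.support
  · have hlt := Q.length_takeUntil_lt_length hu hz.ne.symm
    have := hG u P (Q.takeUntil u hu) hP (hQ.takeUntil hu) (by omega) (by omega)
    rw [this] at hQP
    omega
  · have := hG u P (Q.concat hz) hP (hQ.concat hu hz) (by omega)
      (by rw [Walk.length_concat]; omega)
    rw [this, Walk.penultimate_concat]

theorem neighborhood_le (G : SimpleGraph V) (v : V) (r : ℕ) : neighborhood G v r ≤ G :=
  fun _ _ h => h.1

theorem UniquePaths.length_eq (hG : UniquePaths G v L) {x : V} {P : G.Walk v x}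
    (hP : P.IsPath) (hPL : P.length ≤ L) : G.edist v x = P.length := by
  obtain ⟨Q, hQ⟩ := exists_walk_of_edist_ne_top
    (ne_top_of_le_ne_top (ENat.natCast_ne_top P.length) (edist_le P))
  have hQP : Q.length ≤ P.length := by
    have := edist_le P
    rw [← hQ] at this
    exact_mod_cast this
  have := hG x P Q hP (isPath_of_length_eq_edist Q hQ) hPL (hQP.trans hPL)
  rw [this, hQ]

theorem edist_neighborhood_le {x : V} {r : ℕ} (P : G.Walk v x) (hP : P.length ≤ r) :
    (neighborhood G v r).edist v x ≤ P.length := by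
  classical
  have hd : ∀ w ∈ P.support, G.edist v w ≤ r := fun w hw =>
    (edist_le (P.takeUntil w hw)).trans
      (by exact_mod_cast (P.length_takeUntil_le_length hw).trans hP)
  have hT : ∀ e ∈ P.edges, e ∈ (neighborhood G v r).edgeSet := by
    intro e he
    induction e with
    | _ a b =>
      exact ⟨P.adj_of_mem_edges he, hd a (P.fst_mem_support_of_mem_edges he),
        hd b (P.snd_mem_support_of_mem_edges he)⟩
  have := edist_le (P.transfer _ hT)
  rwa [Walk.length_transfer] at this

theorem edist_le_edist_neighborhood (x : V) (r : ℕ) :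
    G.edist v x ≤ (neighborhood G v r).edist v x := by
  by_cases h : (neighborhood G v r).edist v x = ⊤
  · rw [h]
    exact le_top
  · obtain ⟨P, hP⟩ := exists_walk_of_edist_ne_top h
    rw [← hP, ← Walk.length_mapLe (neighborhood_le G v r)]
    exact edist_le _

/-- The ancestors of a node are the nodes of the path from the root to it. -/
theorem UniquePaths.mem_support_of_isAncestor (hG : UniquePaths G v L) {r : ℕ} (hr : r ≤ L)
    {x w : V} {P : G.Walk v x} (hP : P.IsPath) (hPr : P.length = r)
    (hw : IsAncestor (neighborhood G v r) v w x) : w ∈ P.support := by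
  have hx : (neighborhood G v r).edist v x = r := by
    refine le_antisymm ((edist_neighborhood_le P hPr.le).trans_eq (by rw [hPr])) ?_
    rw [← hPr, ← hG.length_eq hP (hPr.le.trans hr)]
    exact edist_le_edist_neighborhood x _
  rw [IsAncestor, hx] at hw
  obtain ⟨A, hA⟩ := exists_walk_of_edist_ne_top (G := neighborhood G v r) (u := v) (v := w)
    (by intro h; rw [h, top_add] at hw; exact ENat.natCast_ne_top r hw.symm)
  obtain ⟨B, hB⟩ := exists_walk_of_edist_ne_top (G := neighborhood G v r) (u := w) (v := x)
    (by intro h; rw [h, add_top] at hw; exact ENat.natCast_ne_top r hw.symm)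
  have hlen : ((A.append B).length : ℕ∞) = r := by
    rw [Walk.length_append, Nat.cast_add, hA, hB, hw]
  have hpath : (A.append B).IsPath := isPath_of_length_eq_edist _ (hlen.trans hx.symm)
  have hlen' : (A.append B).length = r := by exact_mod_cast hlen
  have := hG x P ((A.append B).mapLe (neighborhood_le G v r)) hP
    ((Walk.isPath_mapLe _).2 hpath) (by omega) (by rw [Walk.length_mapLe]; omega)
  rw [this, Walk.support_mapLe_eq_support]
  exact (Walk.mem_support_append_iff _ _).2 (Or.inl A.end_mem_support)

/-- Two revealed nodes of label `l` at the ends of paths that have small degrees and leave the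
root through different neighbors make `l` a candidate. -/
theorem UniquePaths.mem_candidateLabels [Finite V] {k D r : ℕ} (hG : UniquePaths G v (r + 1))
    (hD : 1 ≤ D) {obs : V → Option (Fin k)} {l : Fin k} {x y : V}
    (hx : obs x = some l) (hy : obs y = some l) {P : G.Walk v x} {Q : G.Walk v y}
    (hP : P.IsPath) (hQ : Q.IsPath) (hPr : P.length = r) (hQr : Q.length = r)
    (hPD : ∀ w ∈ P.support, w ≠ x → (G.neighborSet w).ncard ≤ D)
    (hQD : ∀ w ∈ Q.support, w ≠ y → (G.neighborSet w).ncard ≤ D)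
    (hPQ : P.snd ≠ Q.snd) :
    l ∈ candidateLabels (neighborhood G v r) (observedNear G obs v r) D r v := by
  classical
  have hdist : ∀ {x : V} {P : G.Walk v x}, P.IsPath → P.length = r →
      (neighborhood G v r).edist v x = r ∧ G.edist v x ≤ r := by
    intro x P hP hPr
    have h1 := hG.length_eq hP (by omega)
    refine ⟨le_antisymm ((edist_neighborhood_le P hPr.le).trans_eq (by rw [hPr])) ?_, by rw [h1, hPr]⟩
    rw [← hPr, ← h1]
    exact edist_le_edist_neighborhood x _
  have hsurv : ∀ {x : V} {P : G.Walk v x}, P.IsPath → P.length = r →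
      (∀ w ∈ P.support, w ≠ x → (G.neighborSet w).ncard ≤ D) →
      Survives (neighborhood G v r) D v x := by
    intro x P hP hPr hPD w hw
    have hwP := hG.mem_support_of_isAncestor (by omega) hP hPr hw
    by_cases hwx : w = x
    · subst hwx
      -- An end node at distance `r` is a leaf of the `r`-neighborhood, so its degree in `G` is
      -- irrelevant. Excluding other neighbors at distance at most `r` takes uniqueness of paths up
      -- to length `r + 1`.
      have hsub : (neighborhood G v r).neighborSet w ⊆ {P.penultimate} := by
        intro z hz
        have hz' : (neighborhood G v r).Adj w z := hz
        obtain ⟨Q, hQ, hQr⟩ := exists_path_of_edist_le hz'.2.2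
        exact hG.eq_penultimate hP (by omega) hz'.1.symm hQ (by omega)
      refine (Set.ncard_le_ncard hsub (Set.finite_singleton _)).trans ?_
      rwa [Set.ncard_singleton]
    · refine le_trans (Set.ncard_le_ncard ?_ (Set.toFinite _)) (hPD w hwP hwx)
      exact fun z hz => neighborhood_le G v r hz
  rw [candidateLabels, Finset.mem_filter]
  refine ⟨Finset.mem_univ _, x, y, ?_, ?_, (hdist hP hPr).1, (hdist hQ hQr).1,
    hsurv hP hPr hPD, hsurv hQ hQr hQD, ?_⟩
  · rw [observedNear, if_pos (hdist hP hPr).2, hx]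
  · rw [observedNear, if_pos (hdist hQ hQr).2, hy]
  · intro w hwx hwy
    have h1 := hG.mem_support_of_isAncestor (by omega) hP hPr hwx
    have h2 := hG.mem_support_of_isAncestor (by omega) hQ hQr hwy
    by_contra hne
    have l1 := P.length_takeUntil_le_length h1
    have l2 := Q.length_takeUntil_le_length h2
    -- A common ancestor other than the root would force equal initial segments, hence equal first
    -- steps.
    have := hG w (P.takeUntil w h1) (Q.takeUntil w h2) (hP.takeUntil h1) (hQ.takeUntil h2)
      (by omega) (by omega)
    apply hPQ
    rw [← Walk.snd_takeUntil hne P h1, ← Walk.snd_takeUntil hne Q h2, this]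

/-- Nodes of `Q` are moved one by one to the front of the path until the next one already lies on
it, at the latest at `v`. That node gives the back edge; its index is neither `0` nor `1`, because
it differs from the current first node and from the successor of that node. The total length bounded
by `n` is preserved. -/
theorem exists_backEdge_aux {x x' v : V} (n : ℕ) (P : G.Walk x' v) (hx : G.Adj x x')
    (hP : (Walk.cons hx P).IsPath) {y : V} (hy : G.Adj y x) (hne : y ≠ x') (Q : G.Walk y v)
    (hQ : Q.IsPath) (hxQ : x ∉ Q.support) (hn : P.length + 1 + Q.length ≤ n) :
    ∃ (u : V) (R : G.Walk u v) (j : ℕ), R.IsPath ∧ R.length ≤ n ∧ 2 ≤ j ∧ j ≤ R.length ∧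
      G.Adj u (R.getVert j) := by
  induction Q generalizing x x' with
  | nil =>
    rename_i y
    obtain ⟨j, hj, hjl⟩ := Walk.mem_support_iff_exists_getVert.1
      (Walk.cons hx P).end_mem_support
    refine ⟨x, Walk.cons hx P, j, hP, by simpa using hn, ?_, hjl, by rw [hj]; exact hy.symm⟩
    by_contra hlt
    have : j = 0 ∨ j = 1 := by omega
    rcases this with rfl | rfl
    · rw [Walk.getVert_zero] at hj
      exact hy.ne hj.symm
    · rw [Walk.getVert_cons_succ, Walk.getVert_zero] at hj
      exact hne hj.symm
  | cons h Q ih =>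
    rename_i a y' b
    by_cases hmem : a ∈ (Walk.cons hx P).support
    · obtain ⟨j, hj, hjl⟩ := Walk.mem_support_iff_exists_getVert.1 hmem
      refine ⟨x, Walk.cons hx P, j, hP, ?_, ?_, hjl, hj ▸ hy.symm⟩
      · rw [Walk.length_cons] at hn ⊢
        omega
      by_contra hlt
      have : j = 0 ∨ j = 1 := by omega
      rcases this with rfl | rfl
      · rw [Walk.getVert_zero] at hj
        exact hy.ne hj.symm
      · rw [Walk.getVert_cons_succ, Walk.getVert_zero] at hj
        exact hne hj.symm
    · rw [Walk.cons_isPath_iff] at hQ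
      refine ih (Walk.cons hx P) hy (hP.cons hmem) h.symm ?_ hQ.1 hQ.2 ?_
      · rintro rfl
        exact hxQ (by simp)
      · rw [Walk.length_cons] at hn ⊢
        omega

/-- If the paths from `v` are not unique, there is a path from `v` whose end is also adjacent to
an earlier node of the path. -/
theorem exists_backEdge_of_not_uniquePaths (h : ¬ UniquePaths G v L) :
    ∃ (u : V) (R : G.Walk u v) (j : ℕ), R.IsPath ∧ R.length ≤ 2 * L ∧ 2 ≤ j ∧ j ≤ R.length ∧
      G.Adj u (R.getVert j) := by
  have main : ∀ (x : V) (P Q : G.Walk x v), P.IsPath → Q.IsPath → P.length ≤ L → Q.length ≤ L →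
      P ≠ Q → ∃ (u : V) (R : G.Walk u v) (j : ℕ), R.IsPath ∧ R.length ≤ 2 * L ∧ 2 ≤ j ∧
        j ≤ R.length ∧ G.Adj u (R.getVert j) := by
    clear h
    intro x P
    induction P with
    | nil =>
      intro Q _ hQ _ _ hne
      exact absurd (Walk.isPath_iff_nil.1 hQ).eq_nil.symm hne
    | cons hx P ih =>
      rename_i x x' v'
      intro Q hP hQ hPL hQL hne
      cases Q with
      | nil => exact absurd (Walk.isPath_iff_nil.1 hP) Walk.not_nil_cons
      | cons hy Q =>
        rename_i y
        by_cases hxy : x' = y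
        -- Common first steps are stripped off; where the two paths diverge, the auxiliary lemma
        -- applies.
        · subst hxy
          refine ih Q hP.of_cons hQ.of_cons ?_ ?_ fun h => hne (by rw [h])
          · rw [Walk.length_cons] at hPL
            omega
          · rw [Walk.length_cons] at hQL
            omega
        · rw [Walk.length_cons] at hPL hQL
          rw [Walk.cons_isPath_iff] at hQ
          exact exists_backEdge_aux (2 * L) P hx hP hy.symm (Ne.symm hxy) Q hQ.1 hQ.2 (by omega)
  simp only [UniquePaths, not_forall] at h
  obtain ⟨x, P, Q, hP, hQ, hPL, hQL, hne⟩ := h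
  refine main x P.reverse Q.reverse hP.reverse hQ.reverse ?_ ?_ ?_
  · rwa [Walk.length_reverse]
  · rwa [Walk.length_reverse]
  · exact fun h => hne (Walk.reverse_injective h)

end UniquePaths

/-! ### Discovered nodes as ends of paths. -/

section ExplorationPaths

open SimpleGraph

variable {V : Type*} [Fintype V] [DecidableEq V]
  {C : Finset V} {K : Bool → Finset V} {D : ℕ} {v : V} {S : Finset (Sym2 V)}

theorem adj_of_mem_offspring {B : Finset V} {u w : V} (hu : u ∈ B)
    (h : w ∈ offspring C D S B u) : (fromEdgeSet (S : Set (Sym2 V))).Adj u w := by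
  rw [mem_offspring] at h
  rw [fromEdgeSet_adj]
  exact ⟨by exact_mod_cast h.2.2.1, fun e => h.2.1 (e ▸ hu)⟩

/-- The discovered nodes are ends of paths of seen nodes. -/
theorem exists_path_of_mem_exploration (j : ℕ) (g : Bool) {u : V}
    (hu : u ∈ (exploration C K D v S j).2 g) :
    ∃ P : (fromEdgeSet (S : Set (Sym2 V))).Walk v u, P.IsPath ∧ P.length = j + 1 ∧
      ∀ w ∈ P.support, w ∈ seenNodes (exploration C K D v S j) := by
  induction j generalizing u with
  | zero =>
    have hadj := adj_of_mem_offspring (Finset.mem_singleton_self v) hu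
    refine ⟨hadj.toWalk, Walk.IsPath.of_adj hadj, by simp, ?_⟩
    intro w hw
    simp only [Walk.support_cons, Walk.support_nil, List.mem_cons, List.not_mem_nil,
      or_false] at hw
    rcases hw with rfl | rfl
    · exact explored_subset_seenNodes _ (Finset.mem_singleton_self w)
    · exact group_subset_seenNodes _ g hu
  | succ j ih =>
    obtain ⟨u', hu', huo⟩ := Finset.mem_biUnion.1 hu
    obtain ⟨P, hP, hPl, hPs⟩ := ih hu'
    have hadj := adj_of_mem_offspring (group_subset_seenNodes _ g hu') huo
    have hun : u ∉ P.support := fun h => (mem_offspring.1 huo).2.1 (hPs u h)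
    refine ⟨P.concat hadj, hP.concat hun hadj, by rw [Walk.length_concat, hPl], ?_⟩
    intro w hw
    rw [Walk.support_concat, List.mem_append, List.mem_singleton] at hw
    rcases hw with hw | rfl
    · exact explored_subset_seenNodes _ (hPs w hw)
    · exact group_subset_seenNodes _ g hu

theorem exists_path_of_mem_seenNodes (j : ℕ) {w : V}
    (hw : w ∈ seenNodes (exploration C K D v S j)) :
    ∃ P : (fromEdgeSet (S : Set (Sym2 V))).Walk v w, P.IsPath ∧ P.length ≤ j + 1 := by
  induction j with
  | zero =>
    simp only [seenNodes, Finset.mem_union] at hw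
    rcases hw with (hw | hw) | hw
    · obtain rfl : w = v := Finset.mem_singleton.1 hw
      exact ⟨Walk.nil, Walk.IsPath.nil, by simp⟩
    all_goals
      obtain ⟨P, hP, hl, -⟩ := exists_path_of_mem_exploration 0 _ hw
      exact ⟨P, hP, hl.le⟩
  | succ j ih =>
    simp only [seenNodes, Finset.mem_union] at hw
    rcases hw with (hw | hw) | hw
    · obtain ⟨P, hP, hl⟩ := ih hw
      exact ⟨P, hP, by omega⟩
    all_goals
      obtain ⟨P, hP, hl, -⟩ := exists_path_of_mem_exploration (j + 1) _ hw
      exact ⟨P, hP, hl.le⟩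

/-- Where paths are unique, the discovered nodes are the ends of paths of small degree. -/
theorem exists_path_degree_le {L : ℕ} (hG : UniquePaths (fromEdgeSet (S : Set (Sym2 V))) v L)
    (j : ℕ) (hj : j + 1 ≤ L) (g : Bool) {u : V} (hu : u ∈ (exploration C K D v S j).2 g) :
    ∃ P : (fromEdgeSet (S : Set (Sym2 V))).Walk v u, P.IsPath ∧ P.length = j + 1 ∧
      P.snd ∈ K g ∧
      ∀ w ∈ P.support, w ≠ u →
        ((fromEdgeSet (S : Set (Sym2 V))).neighborSet w).ncard ≤ D := by
  induction j generalizing u with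
  | zero =>
    have hadj := adj_of_mem_offspring (Finset.mem_singleton_self v) hu
    refine ⟨hadj.toWalk, Walk.IsPath.of_adj hadj, by simp, ?_, ?_⟩
    · simpa using (mem_offspring.1 hu).2.2.2
    intro w hw hwu
    simp only [Walk.support_cons, Walk.support_nil, List.mem_cons, List.not_mem_nil,
      or_false] at hw
    obtain rfl := hw.resolve_right hwu
    have hsub : (fromEdgeSet (S : Set (Sym2 V))).neighborSet w ⊆
        (freshNeighbors S {w} w : Set V) := by
      intro z hz
      rw [mem_neighborSet, fromEdgeSet_adj] at hz
      simp only [freshNeighbors, Finset.coe_filter, Finset.mem_univ, true_and,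
        Finset.mem_singleton, Set.mem_ofPred_eq]
      exact ⟨hz.2.symm, by exact_mod_cast hz.1⟩
    refine (Set.ncard_le_ncard hsub (Finset.finite_toSet _)).trans ?_
    rw [Set.ncard_coe_finset]
    exact (mem_offspring.1 hu).1.le
  | succ j ih =>
    obtain ⟨u', hu', huo⟩ := Finset.mem_biUnion.1 hu
    obtain ⟨P, hP, hPl, hPK, hPD⟩ := ih (by omega) hu'
    obtain ⟨P', hP', hPl', hPs'⟩ := exists_path_of_mem_exploration j g hu'
    -- One path comes with the degree bounds, the other with the fact that its nodes are seen;
    -- uniqueness identifies them.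
    obtain rfl := hG u' P P' hP hP' (by omega) (by omega)
    have hadj := adj_of_mem_offspring (group_subset_seenNodes _ g hu') huo
    have hun : u ∉ P.support := fun h => (mem_offspring.1 huo).2.1 (hPs' u h)
    refine ⟨P.concat hadj, hP.concat hun hadj, by rw [Walk.length_concat, hPl], ?_, ?_⟩
    · rw [Walk.snd, Walk.concat_eq_append, Walk.getVert_append]
      rcases Nat.lt_or_ge 1 P.length with h1 | h1
      · rwa [if_pos h1]
      · have h1' : P.length = 1 := by omega
        rw [if_neg (by omega), h1', Nat.sub_self, Walk.getVert_zero]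
        rw [Walk.snd, ← h1', Walk.getVert_length] at hPK
        exact hPK
    · intro w hw hwu
      rw [Walk.support_concat, List.mem_append, List.mem_singleton] at hw
      have hwP := hw.resolve_right hwu
      by_cases hwu' : w = u'
      swap
      · exact hPD w hwP hwu'
      subst hwu'
      have hsub : (fromEdgeSet (S : Set (Sym2 V))).neighborSet w ⊆
          (insert P.penultimate (freshNeighbors S (seenNodes (exploration C K D v S j)) w) :
            Finset V) := by
        intro z hz
        rw [mem_neighborSet] at hz
        have hzS := (fromEdgeSet_adj _).1 hz
        rw [Finset.mem_coe, Finset.mem_insert]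
        by_cases hzs : z ∈ seenNodes (exploration C K D v S j)
        · left
          obtain ⟨Q, hQ, hQl⟩ := exists_path_of_mem_seenNodes j hzs
          exact hG.eq_penultimate hP (by omega) hz.symm hQ (by omega)
        · right
          simp only [freshNeighbors, Finset.mem_filter, Finset.mem_univ, true_and]
          exact ⟨hzs, by exact_mod_cast hzS.1⟩
      refine (Set.ncard_le_ncard hsub (Finset.finite_toSet _)).trans ?_
      rw [Set.ncard_coe_finset]
      -- The parent adds one to fewer than `D` fresh neighbors; this is why `offspring` has a strict
      -- inequality.
      exact (Finset.card_insert_le _ _).trans (mem_offspring.1 huo).1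

/-- A node discovered by two parents would end two paths of length `j + 2` with different
penultimate nodes. This supplies the hypothesis `hZ` of `bprob_growsUntil_ge`. -/
theorem card_exploration_succ {L : ℕ} (hG : UniquePaths (fromEdgeSet (S : Set (Sym2 V))) v L)
    (j : ℕ) (hj : j + 2 ≤ L) (g : Bool) :
    ((exploration C K D v S (j + 1)).2 g).card =
      ∑ u ∈ (exploration C K D v S j).2 g,
        (offspring C D S (seenNodes (exploration C K D v S j)) u).card := by
  refine Finset.card_biUnion fun u hu u' hu' hne => ?_
  change Disjoint _ _
  rw [Finset.disjoint_left]
  intro x hx hx'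
  obtain ⟨P, hP, hPl, hPs⟩ := exists_path_of_mem_exploration j g hu
  obtain ⟨Q, hQ, hQl, hQs⟩ := exists_path_of_mem_exploration j g hu'
  have h1 := adj_of_mem_offspring (group_subset_seenNodes _ g hu) hx
  have h2 := adj_of_mem_offspring (group_subset_seenNodes _ g hu') hx'
  have hxP : x ∉ P.support := fun h => (mem_offspring.1 hx).2.1 (hPs x h)
  have hxQ : x ∉ Q.support := fun h => (mem_offspring.1 hx).2.1 (hQs x h)
  have := hG x _ _ (hP.concat hxP h1) (hQ.concat hxQ h2) (by rw [Walk.length_concat]; omega)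
    (by rw [Walk.length_concat]; omega)
  have e := congrArg Walk.penultimate this
  rw [Walk.penultimate_concat, Walk.penultimate_concat] at e
  exact hne e

end ExplorationPaths

/-! ### Union bounds for back edges and for pairs of wrongly labeled nodes. -/

section UnionBounds

open SimpleGraph

variable {V : Type*} [Fintype V] [DecidableEq V]

theorem bprob_le_of_subset_iUnion {ι κ : Type*} [Fintype ι] [DecidableEq ι] [Fintype κ]
    (q : ι → unitInterval) {E : Set (Finset ι)} {F : κ → Set (Finset ι)} {c : κ → ℝ}
    (h : ∀ S ∈ E, ∃ k, S ∈ F k) (hc : ∀ k, bprob q (F k) ≤ c k) : bprob q E ≤ ∑ k, c k := by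
  refine le_trans (bprob_mono q (F := ⋃ k ∈ Finset.univ, F k) fun S hS => ?_)
    ((bprob_iUnion_le q _ _).trans (Finset.sum_le_sum fun k _ => hc k))
  obtain ⟨k, hk⟩ := h S hS
  exact Set.mem_biUnion (Finset.mem_coe.2 (Finset.mem_univ k)) hk

theorem bprob_subset_and_le {ι : Type*} [Fintype ι] [DecidableEq ι] (q : ι → unitInterval)
    (T : Finset ι) {p : Prop} {c : ℝ} (hc : 0 ≤ c) (h : p → ∏ i ∈ T, (q i : ℝ) ≤ c) :
    bprob q {S | p ∧ T ⊆ S} ≤ c := by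
  by_cases hp : p
  · have e : {S : Finset ι | p ∧ T ⊆ S} = {S | T ⊆ S} := by
      ext S
      simp [hp]
    rw [e, bprob_subset]
    exact h hp
  · have e : {S : Finset ι | p ∧ T ⊆ S} = ∅ := by
      ext S
      simp [hp]
    rw [e]
    simpa [bprob, bexp] using hc

omit [Fintype V] [DecidableEq V] in
theorem sym2_path_injOn {p : ℕ → V} {l : ℕ} (hp : Set.InjOn p {i | i ≤ l}) {i j : ℕ}
    (hi : i < l) (hj : j < l) (h : s(p i, p (i + 1)) = s(p j, p (j + 1))) : i = j := by
  have inj : ∀ a b, a ≤ l → b ≤ l → p a = p b → a = b := fun a b ha hb => hp ha hb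
  rcases Sym2.eq_iff.1 h with ⟨h1, -⟩ | ⟨h1, h2⟩
  · exact inj _ _ hi.le hj.le h1
  · have e1 := inj _ _ hi.le hj h1
    have e2 := inj _ _ hi hj.le h2
    omega

/-- The sequence `f 0, …, f (l - 1), v, v, …`. -/
def extendBy (v : V) {l : ℕ} (f : Fin l → V) (i : ℕ) : V := if h : i < l then f ⟨i, h⟩ else v

/-- The pairs of consecutive nodes of a sequence that ends in `v`, and a pair of its first node
and another one. -/
def backEdgePairs (v : V) {l : ℕ} (f : Fin l → V) (j : ℕ) : Finset (Sym2 V) :=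
  insert s(extendBy v f 0, extendBy v f j)
    ((Finset.range l).image fun i => s(extendBy v f i, extendBy v f (i + 1)))

omit [Fintype V] in
theorem card_backEdgePairs {v : V} {l : ℕ} {f : Fin l → V} {j : ℕ} (hj : 2 ≤ j) (hjl : j ≤ l)
    (hf : Set.InjOn (extendBy v f) {i | i ≤ l}) : (backEdgePairs v f j).card = l + 1 := by
  rw [backEdgePairs, Finset.card_insert_of_notMem, Finset.card_image_of_injOn,
    Finset.card_range]
  · intro i hi i' hi' h
    exact sym2_path_injOn hf (Finset.mem_range.1 hi) (Finset.mem_range.1 hi') h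
  · intro hmem
    obtain ⟨i, hi, h⟩ := Finset.mem_image.1 hmem
    have hi := Finset.mem_range.1 hi
    have inj : ∀ a b, a ≤ l → b ≤ l → extendBy v f a = extendBy v f b → a = b :=
      fun a b ha hb => hf ha hb
    rcases Sym2.eq_iff.1 h with ⟨h1, h2⟩ | ⟨h1, h2⟩
    · have e1 := inj _ _ hi.le (Nat.zero_le _) h1
      have e2 := inj _ _ hi hjl h2
      omega
    · have e2 := inj _ _ hi (Nat.zero_le _) h2
      omega

/-- In a sparse random graph paths of bounded length from a node are unique with high
probability. -/
theorem bprob_not_uniquePaths_le (q : Sym2 V → unitInterval) (v : V) (L : ℕ) {β : ℝ}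
    (hβ0 : 0 ≤ β) (hβ : ∀ e, (q e : ℝ) ≤ β) :
    bprob q {S | ¬ UniquePaths (fromEdgeSet (S : Set (Sym2 V))) v L} ≤
      ∑ l : Fin (2 * L + 1), ∑ _j : Fin (2 * L + 1),
        (Fintype.card V : ℝ) ^ (l : ℕ) * β ^ ((l : ℕ) + 1) := by
  -- The path ends at the fixed node `v`, so there are `l` free nodes but `l + 1` distinct edges.
  -- With `β` of order `1 / n` each term is of order `1 / n`.
  have hterm : ∀ (l j : Fin (2 * L + 1)), bprob q {S | ∃ f : Fin l → V,
      S ∈ {S : Finset (Sym2 V) | ((2 ≤ (j : ℕ) ∧ (j : ℕ) ≤ l) ∧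
        Set.InjOn (extendBy v f) {i | i ≤ (l : ℕ)}) ∧ backEdgePairs v f j ⊆ S}} ≤
      (Fintype.card V : ℝ) ^ (l : ℕ) * β ^ ((l : ℕ) + 1) := by
    intro l j
    refine (bprob_le_of_subset_iUnion q (c := fun _ : Fin l → V => β ^ ((l : ℕ) + 1))
      (F := fun f : Fin l → V => {S : Finset (Sym2 V) | ((2 ≤ (j : ℕ) ∧ (j : ℕ) ≤ l) ∧
        Set.InjOn (extendBy v f) {i | i ≤ (l : ℕ)}) ∧ backEdgePairs v f j ⊆ S})
      (fun S hS => hS) fun f => ?_).trans (le_of_eq (by simp))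
    refine bprob_subset_and_le q _ (by positivity) fun h => ?_
    rw [← card_backEdgePairs h.1.1 h.1.2 h.2, ← Finset.prod_const]
    exact Finset.prod_le_prod (fun e _ => (q e).2.1) fun e _ => hβ e
  refine bprob_le_of_subset_iUnion q (fun S hS => ?_)
    (fun l => bprob_le_of_subset_iUnion q (fun S hS => ?_) (hterm l))
    (F := fun l : Fin (2 * L + 1) => {S | ∃ j : Fin (2 * L + 1), S ∈ {S | ∃ f : Fin l → V,
      S ∈ {S : Finset (Sym2 V) | ((2 ≤ (j : ℕ) ∧ (j : ℕ) ≤ l) ∧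
        Set.InjOn (extendBy v f) {i | i ≤ (l : ℕ)}) ∧ backEdgePairs v f j ⊆ S}}})
  swap
  · exact hS
  obtain ⟨u, R, j, hR, hRL, hj, hjR, hadj⟩ := exists_backEdge_of_not_uniquePaths hS
  refine ⟨⟨R.length, by omega⟩, ⟨j, by omega⟩, fun i => R.getVert i, ⟨⟨hj, hjR⟩, ?_⟩, ?_⟩
  all_goals
    have hext : extendBy v (fun i : Fin R.length => R.getVert i) = R.getVert := by
      funext i
      rw [extendBy]
      split_ifs with h
      · rfl
      · rw [Walk.getVert_of_length_le _ (by omega)]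
  · change Set.InjOn (extendBy v (fun i : Fin R.length => R.getVert i)) _
    rw [hext]
    exact hR.getVert_injOn
  · change backEdgePairs v (fun i : Fin R.length => R.getVert i) j ⊆ S
    rw [backEdgePairs, hext, Finset.insert_subset_iff, Walk.getVert_zero]
    refine ⟨by exact_mod_cast ((fromEdgeSet_adj _).1 hadj).1, ?_⟩
    intro e he
    obtain ⟨i, hi, rfl⟩ := Finset.mem_image.1 he
    exact_mod_cast ((fromEdgeSet_adj _).1 (R.adj_getVert_succ (Finset.mem_range.1 hi))).1

variable {k : ℕ}

/-- The expected number of walks of length `r` from `v` to a node of label `l`. -/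
noncomputable def walkWeight (q : Sym2 V → unitInterval) (σ : V → Fin k) (l : Fin k) :
    ℕ → V → ℝ
  | 0, v => if σ v = l then 1 else 0
  | r + 1, v => ∑ x, (q s(v, x) : ℝ) * walkWeight q σ l r x

/-- The weight of the walk from `v` through the nodes `f`. -/
noncomputable def pathWeight (q : Sym2 V → unitInterval) (v : V) {r : ℕ} (f : Fin r → V) : ℝ :=
  ∏ i : Fin r, (q s(Fin.cons (α := fun _ => V) v f i.castSucc,
    Fin.cons (α := fun _ => V) v f i.succ) : ℝ)

omit [DecidableEq V] in
theorem sum_pathWeight (q : Sym2 V → unitInterval) (σ : V → Fin k) (l : Fin k) (r : ℕ) (v : V) :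
    ∑ f : Fin r → V,
      pathWeight q v f *
        (if σ (Fin.cons (α := fun _ => V) v f (Fin.last r)) = l then 1 else 0) =
      walkWeight q σ l r v := by
  induction r generalizing v with
  | zero => simp [pathWeight, walkWeight, Fin.last]
  | succ r ih =>
    rw [walkWeight, ← (Fin.consEquiv fun _ : Fin (r + 1) => V).sum_comp, Fintype.sum_prod_type]
    refine Finset.sum_congr rfl fun x _ => ?_
    rw [← ih x, Finset.mul_sum]
    refine Finset.sum_congr rfl fun f _ => ?_
    rw [pathWeight, Fin.prod_univ_succ, pathWeight, ← mul_assoc]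
    simp only [Fin.consEquiv, Equiv.coe_fn_mk, Fin.castSucc_zero, Fin.cons_zero, Fin.cons_succ,
      ← Fin.succ_castSucc, ← Fin.succ_last]

omit [Fintype V] [DecidableEq V] in
theorem cons_getVert {G : SimpleGraph V} {v x : V} (P : G.Walk v x) {r : ℕ} (i : Fin (r + 1)) :
    Fin.cons (α := fun _ => V) v (fun i : Fin r => P.getVert (i + 1)) i = P.getVert i := by
  refine Fin.cases ?_ (fun i => ?_) i
  · simp
  · simp

/-- There are two nodes of equal label different from that of `v`, at the ends of paths of
length `r` from `v` that meet only in `v`. -/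
def HasForeignPair (σ : V → Fin k) (v : V) (r : ℕ) (G : SimpleGraph V) : Prop :=
  ∃ (x y : V) (P : G.Walk v x) (Q : G.Walk v y), σ x = σ y ∧ σ x ≠ σ v ∧ P.IsPath ∧ Q.IsPath ∧
    P.length = r ∧ Q.length = r ∧ ∀ w ∈ P.support, w ∈ Q.support → w = v

-- All nodes of a shortest path are ancestors of its end, so shortest paths to two nodes whose first
-- common ancestor is the root meet only there. The degree condition plays no role for this
-- direction.
omit [Fintype V] [DecidableEq V] in
theorem hasForeignPair_of_mem_candidateLabels {G : SimpleGraph V} {σ : V → Fin k}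
    {obs : V → Option (Fin k)} (hobs : ∀ u l, obs u = some l → σ u = l) {v : V} {D r : ℕ}
    {l : Fin k}
    (h : l ∈ candidateLabels (neighborhood G v r) (observedNear G obs v r) D r v)
    (hl : l ≠ σ v) : HasForeignPair σ v r G := by
  classical
  rw [candidateLabels, Finset.mem_filter] at h
  obtain ⟨-, x, y, hx, hy, hxr, hyr, -, -, hxy⟩ := h
  have hlab : ∀ u, observedNear G obs v r u = some l → σ u = l := by
    intro u hu
    rw [observedNear] at hu
    split_ifs at hu
    exact hobs u l hu
  obtain ⟨P, hP⟩ := exists_walk_of_edist_ne_top (G := neighborhood G v r) (u := v) (v := x)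
    (by rw [hxr]; exact ENat.natCast_ne_top r)
  obtain ⟨Q, hQ⟩ := exists_walk_of_edist_ne_top (G := neighborhood G v r) (u := v) (v := y)
    (by rw [hyr]; exact ENat.natCast_ne_top r)
  have hanc : ∀ {x : V} {P : (neighborhood G v r).Walk v x},
      (P.length : ℕ∞) = (neighborhood G v r).edist v x →
      ∀ w ∈ P.support, IsAncestor (neighborhood G v r) v w x := by
    intro x P hP w hw
    refine le_antisymm ?_ SimpleGraph.edist_triangle
    rw [← hP, ← congrArg Walk.length (P.take_spec hw), Walk.length_append, Nat.cast_add]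
    exact add_le_add (edist_le _) (edist_le _)
  refine ⟨x, y, P.mapLe (neighborhood_le G v r), Q.mapLe (neighborhood_le G v r),
    (hlab x hx).trans (hlab y hy).symm, fun e => hl ((hlab x hx).symm.trans e),
    (Walk.isPath_mapLe _).2 (isPath_of_length_eq_edist P hP),
    (Walk.isPath_mapLe _).2 (isPath_of_length_eq_edist Q hQ), ?_, ?_, ?_⟩
  · rw [Walk.length_mapLe]
    exact_mod_cast hP.trans hxr
  · rw [Walk.length_mapLe]
    exact_mod_cast hQ.trans hyr
  · intro w hwP hwQ
    rw [Walk.support_mapLe_eq_support] at hwP hwQ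
    exact hxy w (hanc hP w hwP) (hanc hQ w hwQ)

/-- The edges of the walk from `v` through the nodes `f`. -/
def consPairs (v : V) {r : ℕ} (f : Fin r → V) : Finset (Sym2 V) :=
  Finset.univ.image fun i : Fin r => s(Fin.cons (α := fun _ => V) v f i.castSucc,
    Fin.cons (α := fun _ => V) v f i.succ)

omit [Fintype V] in
theorem prod_consPairs (q : Sym2 V → unitInterval) {v : V} {r : ℕ} {f : Fin r → V}
    (hf : Function.Injective (Fin.cons (α := fun _ => V) v f)) :
    ∏ e ∈ consPairs v f, (q e : ℝ) = pathWeight q v f := by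
  rw [consPairs, Finset.prod_image, pathWeight]
  intro i _ j _ h
  rcases Sym2.eq_iff.1 h with ⟨h1, -⟩ | ⟨h1, h2⟩
  · exact Fin.castSucc_injective _ (hf h1)
  · have e1 := congrArg Fin.val (hf h1)
    have e2 := congrArg Fin.val (hf h2)
    simp only [Fin.val_castSucc, Fin.val_succ] at e1 e2
    omega

/-- A union bound over the wrong label and the two node sequences. Paths that meet only in `v` share
no edge, so their joint probability is the product of their weights, and summing over both sequences
gives the square. -/
theorem bprob_hasForeignPair_le (q : Sym2 V → unitInterval) (σ : V → Fin k) (v : V) (r : ℕ) :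
    bprob q {S | HasForeignPair σ v r (fromEdgeSet (S : Set (Sym2 V)))} ≤
      ∑ l ∈ Finset.univ.erase (σ v), walkWeight q σ l r v ^ 2 := by
  set c : Fin k → (Fin r → V) → ℝ := fun l f => pathWeight q v f *
    (if σ (Fin.cons (α := fun _ => V) v f (Fin.last r)) = l then 1 else 0) with hc
  have hw0 : ∀ f : Fin r → V, 0 ≤ pathWeight q v f := fun f =>
    Finset.prod_nonneg fun i _ => (q _).2.1
  have hc0 : ∀ l f, 0 ≤ c l f := fun l f => mul_nonneg (hw0 f) (by positivity)
  have hsum : ∑ l ∈ Finset.univ.erase (σ v), walkWeight q σ l r v ^ 2 =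
      ∑ x : (Finset.univ.erase (σ v) : Finset (Fin k)) × (Fin r → V) × (Fin r → V),
        c x.1 x.2.1 * c x.1 x.2.2 := by
    rw [Fintype.sum_prod_type, ← Finset.sum_coe_sort]
    refine Finset.sum_congr rfl fun l _ => ?_
    rw [Fintype.sum_prod_type, ← sum_pathWeight, sq, Finset.sum_mul_sum]
  rw [hsum]
  refine bprob_le_of_subset_iUnion q (F := fun x => {S |
    ((Function.Injective (Fin.cons (α := fun _ => V) v x.2.1) ∧
      Function.Injective (Fin.cons (α := fun _ => V) v x.2.2)) ∧
      (∀ i j, Fin.cons (α := fun _ => V) v x.2.1 i = Fin.cons (α := fun _ => V) v x.2.2 j →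
        Fin.cons (α := fun _ => V) v x.2.1 i = v) ∧
      σ (Fin.cons (α := fun _ => V) v x.2.1 (Fin.last r)) = x.1 ∧
      σ (Fin.cons (α := fun _ => V) v x.2.2 (Fin.last r)) = x.1) ∧
      consPairs v x.2.1 ∪ consPairs v x.2.2 ⊆ S}) ?_ ?_
  · rintro S ⟨x, y, P, Q, hσ, hv, hP, hQ, hPr, hQr, hPQ⟩
    have hinj : ∀ {x : V} {P : (fromEdgeSet (S : Set (Sym2 V))).Walk v x}, P.IsPath →
        P.length = r → Function.Injective
          (Fin.cons (α := fun _ => V) v fun i : Fin r => P.getVert (i + 1)) := by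
      intro x P hP hPr i j hij
      rw [cons_getVert, cons_getVert] at hij
      exact Fin.ext (hP.getVert_injOn (by simp only [Set.mem_ofPred_eq]; omega)
        (by simp only [Set.mem_ofPred_eq]; omega) hij)
    have hsub : ∀ {x : V} {P : (fromEdgeSet (S : Set (Sym2 V))).Walk v x}, P.length = r →
        consPairs v (fun i : Fin r => P.getVert (i + 1)) ⊆ S := by
      intro x P hPr e he
      obtain ⟨i, -, rfl⟩ := Finset.mem_image.1 he
      rw [cons_getVert, cons_getVert]
      exact_mod_cast ((fromEdgeSet_adj _).1 (P.adj_getVert_succ (i := i) (by omega))).1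
    have hlast : ∀ {x : V} {P : (fromEdgeSet (S : Set (Sym2 V))).Walk v x}, P.length = r →
        Fin.cons (α := fun _ => V) v (fun i : Fin r => P.getVert (i + 1)) (Fin.last r) = x := by
      intro x P hPr
      rw [cons_getVert, Fin.val_last, ← hPr, Walk.getVert_length]
    refine ⟨⟨⟨σ x, Finset.mem_erase.2 ⟨hv, Finset.mem_univ _⟩⟩,
      fun i => P.getVert (i + 1), fun i => Q.getVert (i + 1)⟩,
      ⟨⟨hinj hP hPr, hinj hQ hQr⟩, ?_, ?_, ?_⟩, ?_⟩
    · intro i j hij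
      simp only [cons_getVert] at hij ⊢
      exact hPQ _ (P.getVert_mem_support _) (hij ▸ Q.getVert_mem_support _)
    · rw [hlast hPr]
    · exact (congrArg σ (hlast hQr)).trans hσ.symm
    · exact Finset.union_subset (hsub hPr) (hsub hQr)
  · rintro ⟨l, f, g⟩
    refine bprob_subset_and_le q _ (mul_nonneg (hc0 _ _) (hc0 _ _)) ?_
    rintro ⟨⟨hf, hg⟩, hfg, hfl, hgl⟩
    simp only at hf hg hfg hfl hgl
    rw [Finset.prod_union, prod_consPairs q hf, prod_consPairs q hg]
    · simp only [hc, hfl, hgl, if_true, mul_one, le_refl]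
    · rw [Finset.disjoint_left]
      intro e he he'
      obtain ⟨i, -, rfl⟩ := Finset.mem_image.1 he
      obtain ⟨j, -, h⟩ := Finset.mem_image.1 he'
      -- Both ends of a shared edge would equal `v`, contradicting injectivity of the path.
      have h1 : Fin.cons (α := fun _ => V) v f i.castSucc = v ∧
          Fin.cons (α := fun _ => V) v f i.succ = v := by
        rcases Sym2.eq_iff.1 h with ⟨h1, h2⟩ | ⟨h1, h2⟩
        · exact ⟨hfg _ _ h1.symm, hfg _ _ h2.symm⟩
        · exact ⟨hfg _ _ h2.symm, hfg _ _ h1.symm⟩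
      have := congrArg Fin.val (hf (h1.1.trans h1.2.symm))
      simp at this

end UnionBounds

/-! ### Balanced labelings and expected numbers of walks in the block model. -/

section Labels

variable {n k : ℕ}

/-- The nodes of label `s`. -/
def labelClass (σ : Fin n → Fin k) (s : Fin k) : Finset (Fin n) :=
  Finset.univ.filter fun u => σ u = s

/-- All label classes have about the same size. -/
def BalancedLabels (η : ℝ) (σ : Fin n → Fin k) : Prop :=
  ∀ s, |((labelClass σ s).card : ℝ) - n / k| ≤ η * (n / k)

theorem edgeProbability_mk {a b : ℝ} (ha : 0 ≤ a) (hb : 0 ≤ b) (han : a ≤ n) (hbn : b ≤ n)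
    (σ : Fin n → Fin k) (u w : Fin n) :
    (edgeProbability a b σ s(u, w) : ℝ) = if σ w = σ u then a / n else b / n := by
  have h : ∀ x : ℝ, 0 ≤ x → x ≤ n → x / n ∈ Set.Icc (0 : ℝ) 1 := fun x h0 h1 =>
    ⟨by positivity, div_le_one_of_le₀ h1 (by positivity)⟩
  rw [edgeProbability]
  simp only [Sym2.map_mk, Sym2.mk_isDiag_iff]
  by_cases hs : σ u = σ w
  · rw [if_pos hs, if_pos hs.symm, Set.projIcc_of_mem _ (h a ha han)]
  · rw [if_neg hs, if_neg (Ne.symm hs), Set.projIcc_of_mem _ (h b hb hbn)]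

/-- The variance of the class size, multiplied by the number `k ^ n` of labelings: the deviation is
a sum of centered indicators `g (σ u)`, whose mixed products sum to zero over all labelings. -/
theorem sum_sq_card_labelClass_le [NeZero k] (s : Fin k) :
    ∑ σ : Fin n → Fin k, (((labelClass σ s).card : ℝ) - n / k) ^ 2 ≤ n * (k : ℝ) ^ n := by
  have hk : (0 : ℝ) < k := by exact_mod_cast NeZero.pos k
  set g : Fin k → ℝ := fun c => (if c = s then 1 else 0) - 1 / k with hg
  have hg0 : ∑ c, g c = 0 := by
    simp only [hg, Finset.sum_sub_distrib, Finset.sum_ite_eq', Finset.mem_univ, if_true,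
      Finset.sum_const, Finset.card_univ, Fintype.card_fin, nsmul_eq_mul]
    field_simp
    ring
  have hg1 : ∀ c, g c ^ 2 ≤ 1 := by
    intro c
    have h1 : (1 : ℝ) / k ≤ 1 := by
      rw [div_le_one hk]
      exact_mod_cast NeZero.one_le
    have h0 : (0 : ℝ) < 1 / k := by positivity
    simp only [hg]
    split_ifs <;> nlinarith
  have e : ∀ σ : Fin n → Fin k, ((labelClass σ s).card : ℝ) - n / k = ∑ u, g (σ u) := by
    intro σ
    simp only [hg, Finset.sum_sub_distrib, labelClass, Finset.card_filter, Finset.sum_const,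
      Finset.card_univ, Fintype.card_fin, nsmul_eq_mul]
    push_cast
    ring
  have hcross : ∀ u w, ∑ σ : Fin n → Fin k, g (σ u) * g (σ w) ≤
      if w = u then (k : ℝ) ^ n else 0 := by
    intro u w
    split_ifs with h
    · subst h
      calc ∑ σ : Fin n → Fin k, g (σ w) * g (σ w) ≤ ∑ _σ : Fin n → Fin k, (1 : ℝ) :=
            Finset.sum_le_sum fun σ _ => by rw [← sq]; exact hg1 _
        _ = (k : ℝ) ^ n := by simp
    · refine le_of_eq ?_
      -- As a product over all nodes, the term can be summed coordinate by coordinate; the factor at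
      -- `u` is `∑ c, g c = 0`.
      have e1 : ∀ σ : Fin n → Fin k, g (σ u) * g (σ w) =
          ∏ x, (if x = u then g (σ x) else if x = w then g (σ x) else 1) := by
        intro σ
        have : ∀ x, (if x = u then g (σ x) else if x = w then g (σ x) else 1) =
            (if x = u then g (σ x) else 1) * (if x = w then g (σ x) else 1) := by
          intro x
          by_cases h1 : x = u
          · subst h1
            simp [Ne.symm h]
          · simp [h1]
        simp only [this, Finset.prod_mul_distrib, Finset.prod_ite_eq', Finset.mem_univ, if_true]
      simp only [e1]
      rw [← Fintype.piFinset_univ, Finset.sum_prod_piFinset Finset.univ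
        (fun x c => if x = u then g c else if x = w then g c else 1)]
      refine Finset.prod_eq_zero (Finset.mem_univ u) ?_
      simpa using hg0
  calc ∑ σ : Fin n → Fin k, (((labelClass σ s).card : ℝ) - n / k) ^ 2 =
      ∑ u, ∑ w, ∑ σ : Fin n → Fin k, g (σ u) * g (σ w) := by
        simp only [e, sq, Finset.sum_mul_sum]
        rw [Finset.sum_comm]
        exact Finset.sum_congr rfl fun u _ => Finset.sum_comm
    _ ≤ ∑ u : Fin n, ∑ w : Fin n, if w = u then (k : ℝ) ^ n else 0 :=
        Finset.sum_le_sum fun u _ => Finset.sum_le_sum fun w _ => hcross u w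
    _ = n * (k : ℝ) ^ n := by simp

open Classical in
/-- At least half of all labelings are balanced, if there are many nodes. -/
theorem card_balanced_ge [NeZero k] {η : ℝ} (hη : 0 < η) (hn : 2 * (k : ℝ) ^ 3 ≤ η ^ 2 * n) :
    (k : ℝ) ^ n / 2 ≤ ((Finset.univ.filter fun σ : Fin n → Fin k => BalancedLabels η σ).card : ℝ) := by
  have hk : (0 : ℝ) < k := by exact_mod_cast NeZero.pos k
  have hn0 : (0 : ℝ) < n := by
    have : (0 : ℝ) < η ^ 2 * n := lt_of_lt_of_le (by positivity) hn
    exact (pos_iff_pos_of_mul_pos this).1 (by positivity)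
  set bad : Fin k → Finset (Fin n → Fin k) := fun s => Finset.univ.filter fun σ =>
    ¬ |((labelClass σ s).card : ℝ) - n / k| ≤ η * (n / k) with hbad
  -- Chebyshev's inequality as a count. The bound leaves room for a union over the `k` labels.
  have hb : ∀ s, ((bad s).card : ℝ) ≤ (k : ℝ) ^ n / (2 * k) := by
    intro s
    have h1 : ((bad s).card : ℝ) * (η * (n / k)) ^ 2 ≤ n * (k : ℝ) ^ n := by
      refine le_trans ?_ (sum_sq_card_labelClass_le s)
      rw [← nsmul_eq_mul, ← Finset.sum_const]
      refine (Finset.sum_le_sum fun σ hσ => ?_).trans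
        (Finset.sum_le_univ_sum_of_nonneg fun σ => sq_nonneg _)
      rw [← sq_abs ((labelClass σ s).card - (n : ℝ) / k)]
      have := (Finset.mem_filter.1 hσ).2
      push Not at this
      gcongr
    have h2 : n * (k : ℝ) ^ n ≤ ((k : ℝ) ^ n / (2 * k)) * (η * (n / k)) ^ 2 := by
      rw [div_mul_eq_mul_div, le_div_iff₀ (by positivity), mul_pow, div_pow]
      have : (n : ℝ) * (2 * k) ≤ η ^ 2 * (n ^ 2 / k ^ 2) := by
        rw [← mul_div_assoc, le_div_iff₀ (by positivity)]
        nlinarith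
      have hkn : (0 : ℝ) < (k : ℝ) ^ n := by positivity
      nlinarith
    exact le_of_mul_le_mul_right (h1.trans h2) (by positivity)
  have hcov : (Finset.univ : Finset (Fin n → Fin k)) ⊆
      (Finset.univ.filter fun σ : Fin n → Fin k => BalancedLabels η σ) ∪ Finset.univ.biUnion bad := by
    intro σ _
    by_cases h : BalancedLabels η σ
    · exact Finset.mem_union_left _ (Finset.mem_filter.2 ⟨Finset.mem_univ _, h⟩)
    · simp only [BalancedLabels, not_forall] at h
      obtain ⟨s, hs⟩ := h
      exact Finset.mem_union_right _ (Finset.mem_biUnion.2 ⟨s, Finset.mem_univ _,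
        Finset.mem_filter.2 ⟨Finset.mem_univ _, hs⟩⟩)
  have h1 := (Finset.card_le_card hcov).trans (Finset.card_union_le _ _)
  have h2 : ((Finset.univ.biUnion bad).card : ℝ) ≤ (k : ℝ) ^ n / 2 := by
    calc ((Finset.univ.biUnion bad).card : ℝ) ≤ ∑ s, ((bad s).card : ℝ) := by
          exact_mod_cast Finset.card_biUnion_le
      _ ≤ ∑ _s : Fin k, (k : ℝ) ^ n / (2 * k) := Finset.sum_le_sum fun s _ => hb s
      _ = (k : ℝ) ^ n / 2 := by
          rw [Finset.sum_const, Finset.card_univ, Fintype.card_fin, nsmul_eq_mul]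
          field_simp
  have h3 : (k : ℝ) ^ n ≤
      ((Finset.univ.filter fun σ : Fin n → Fin k => BalancedLabels η σ).card : ℝ) +
      ((Finset.univ.biUnion bad).card : ℝ) := by
    have : (Finset.univ : Finset (Fin n → Fin k)).card = k ^ n := by simp
    rw [this] at h1
    exact_mod_cast h1
  linarith

/-- The profile `1 / k + 1_{σ v = l}` is preserved by one step up to a constant factor. The
background `1 / k` yields at most `(b + 2 * (1 + δ)) / k`. Stepping into class `l` contributes at
most `2 * b / k`, plus `2 * (1 + δ)` if `v` is already in it. The factor does not depend on `k`. -/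
theorem walkWeight_le {q : Sym2 (Fin n) → unitInterval} {σ : Fin n → Fin k} {b δ : ℝ}
    (hb : 0 ≤ b) (hδ : 0 ≤ δ) (hn : 0 < n) (hk : 0 < k)
    (hq : ∀ u w, (q s(u, w) : ℝ) = if σ w = σ u then (b + (1 + δ) * k) / n else b / n)
    (hσ : ∀ s, ((labelClass σ s).card : ℝ) ≤ 2 * (n / k)) (l : Fin k) (r : ℕ) (v : Fin n) :
    walkWeight q σ l r v ≤
      (3 * b + 2 * (1 + δ)) ^ r * (1 / k + if σ v = l then 1 else 0) := by
  have hn' : (0 : ℝ) < n := by exact_mod_cast hn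
  have hk' : (0 : ℝ) < k := by exact_mod_cast hk
  induction r generalizing v with
  | zero =>
    rw [walkWeight, pow_zero, one_mul]
    have : (0 : ℝ) ≤ 1 / k := by positivity
    linarith
  | succ r ih =>
    rw [walkWeight]
    set Λ := 3 * b + 2 * (1 + δ) with hΛ
    have hΛ0 : 0 ≤ Λ ^ r := by positivity
    have hind : ∀ (s : Fin k), ∑ x, (if σ x = s then (1 : ℝ) else 0) ≤ 2 * (n / k) := by
      intro s
      refine le_trans (le_of_eq ?_) (hσ s)
      rw [labelClass, Finset.card_filter]
      push_cast
      rfl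
    have hterm : ∀ x, (q s(v, x) : ℝ) * walkWeight q σ l r x ≤
        Λ ^ r * (b / n * (1 / k) + (1 + δ) * k / n * (1 / k) * (if σ x = σ v then 1 else 0) +
          (b / n + (if σ v = l then (1 + δ) * k / n else 0)) * (if σ x = l then 1 else 0)) := by
      intro x
      refine (mul_le_mul_of_nonneg_left (ih x) (q s(v, x)).2.1).trans (le_of_eq ?_)
      rw [hq]
      by_cases h1 : σ x = σ v
      · by_cases h2 : σ x = l
        · have h3 : σ v = l := h1.symm.trans h2
          simp only [h1, h3, if_true]
          ring
        · have h3 : σ v ≠ l := fun h => h2 (h1.trans h)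
          simp only [h1, h3, if_true, if_false]
          ring
      · by_cases h2 : σ x = l
        · have h3 : σ v ≠ l := fun h => h1 (h2.trans h.symm)
          simp only [h2, h3, Ne.symm h3, if_true, if_false]
          ring
        · simp only [h1, h2, if_false]
          ring
    refine (Finset.sum_le_sum fun x _ => hterm x).trans ?_
    rw [← Finset.mul_sum, pow_succ, mul_assoc]
    refine mul_le_mul_of_nonneg_left ?_ hΛ0
    rw [Finset.sum_add_distrib, Finset.sum_add_distrib]
    have c1 : (1 + δ) * k / n * (1 / k) * ∑ x, (if σ x = σ v then (1 : ℝ) else 0) ≤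
        (1 + δ) * k / n * (1 / k) * (2 * (n / k)) :=
      mul_le_mul_of_nonneg_left (hind _) (by positivity)
    have c2 : (b / n + (if σ v = l then (1 + δ) * k / n else 0)) *
        ∑ x, (if σ x = l then (1 : ℝ) else 0) ≤
        (b / n + (if σ v = l then (1 + δ) * k / n else 0)) * (2 * (n / k)) :=
      mul_le_mul_of_nonneg_left (hind _) (by positivity)
    have e0 : ∑ _x : Fin n, b / (n : ℝ) * (1 / k) = b / k := by
      rw [Finset.sum_const, Finset.card_univ, Fintype.card_fin, nsmul_eq_mul]
      field_simp
    have e1 : (1 + δ) * k / n * (1 / k) * (2 * (n / k)) = 2 * (1 + δ) / k := by field_simp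
    have e2 : (b / n + (if σ v = l then (1 + δ) * k / n else 0)) * (2 * (n / k)) =
        2 * b / k + 2 * (1 + δ) * (if σ v = l then 1 else 0) := by
      split_ifs <;> field_simp
      ring
    rw [e0]
    rw [e1, Finset.mul_sum] at c1
    rw [e2, Finset.mul_sum] at c2
    have e3 : Λ * (1 / k + if σ v = l then 1 else 0) =
        b / k + 2 * (1 + δ) / k + (2 * b / k + 2 * (1 + δ) * (if σ v = l then 1 else 0)) +
        3 * b * (if σ v = l then 1 else 0) := by
      rw [hΛ]
      ring
    have : 0 ≤ 3 * b * (if σ v = l then (1 : ℝ) else 0) := by positivity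
    linarith

/-- For a wrong label the walk weight is only its background part, of order `1 / k`; fewer than `k`
squares of it sum to order `1 / k`. -/
theorem bprob_hasForeignPair_le_div {q : Sym2 (Fin n) → unitInterval} {σ : Fin n → Fin k}
    {b δ : ℝ} (hb : 0 ≤ b) (hδ : 0 ≤ δ) (hn : 0 < n) (hk : 0 < k)
    (hq : ∀ u w, (q s(u, w) : ℝ) = if σ w = σ u then (b + (1 + δ) * k) / n else b / n)
    (hσ : ∀ s, ((labelClass σ s).card : ℝ) ≤ 2 * (n / k)) (r : ℕ) (v : Fin n) :
    bprob q {S | HasForeignPair σ v r (SimpleGraph.fromEdgeSet (S : Set (Sym2 (Fin n))))} ≤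
      ((3 * b + 2 * (1 + δ)) ^ r) ^ 2 / k := by
  have hk' : (0 : ℝ) < k := by exact_mod_cast hk
  have hw0 : ∀ l r v, 0 ≤ walkWeight q σ l r v := by
    intro l r
    induction r with
    | zero =>
      intro v
      rw [walkWeight]
      positivity
    | succ r ih =>
      intro v
      rw [walkWeight]
      exact Finset.sum_nonneg fun x _ => mul_nonneg (q _).2.1 (ih x)
  refine (bprob_hasForeignPair_le q σ v r).trans ?_
  have : ∀ l ∈ Finset.univ.erase (σ v), walkWeight q σ l r v ^ 2 ≤
      ((3 * b + 2 * (1 + δ)) ^ r) ^ 2 / k ^ 2 := by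
    intro l hl
    have hne := Finset.ne_of_mem_erase hl
    have := walkWeight_le hb hδ hn hk hq hσ l r v
    rw [if_neg hne.symm, add_zero, mul_one_div] at this
    rw [← div_pow]
    exact pow_le_pow_left₀ (hw0 l r v) this 2
  refine (Finset.sum_le_sum this).trans ?_
  rw [Finset.sum_const, nsmul_eq_mul]
  have hcard : ((Finset.univ.erase (σ v)).card : ℝ) ≤ k := by
    have := Finset.card_le_univ (Finset.univ.erase (σ v))
    rw [Fintype.card_fin] at this
    exact_mod_cast this
  calc ((Finset.univ.erase (σ v)).card : ℝ) * (((3 * b + 2 * (1 + δ)) ^ r) ^ 2 / k ^ 2) ≤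
      k * (((3 * b + 2 * (1 + δ)) ^ r) ^ 2 / k ^ 2) := by gcongr
    _ = _ := by field_simp

end Labels

/-! ### Growth in the class of the root, and revealed nodes in both groups. -/

section Success

open SimpleGraph

variable {n k : ℕ}

theorem mem_labelClass {σ : Fin n → Fin k} {s : Fin k} {u : Fin n} :
    u ∈ labelClass σ s ↔ σ u = s := by
  simp [labelClass]

theorem root_mem_explored {V : Type*} [Fintype V] [DecidableEq V] {C : Finset V}
    {K : Bool → Finset V} {D : ℕ} {v : V} (S : Finset (Sym2 V)) (j : ℕ) :
    v ∈ (exploration C K D v S j).1 := by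
  induction j with
  | zero => exact Finset.mem_singleton_self v
  | succ j ih => exact explored_subset_seenNodes _ ih

set_option maxHeartbeats 1000000 in
/-- With a probability bounded away from zero, the exploration of the label class of `v` grows
geometrically in two groups that leave `v` through different neighbors. -/
theorem exists_bprob_growsUntil_ge {b δ : ℝ} (hb : 0 ≤ b) (hδ : 0 < δ) (hk : 0 < k)
    (q : Sym2 (Fin n) → unitInterval) {σ : Fin n → Fin k}
    (hq : ∀ u w, (q s(u, w) : ℝ) = if σ w = σ u then (b + (1 + δ) * k) / n else b / n)
    (hσ : BalancedLabels (δ / (8 * (1 + δ))) σ) {κ c : ℝ} (hκ : κ = 3 * (1 + δ + b)) {z D r : ℕ}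
    (hz0 : 0 < z)
    (hz : 4 * (κ + κ ^ 2) * (1 + δ / 4) / ((δ / 4) ^ 2 * (δ / 4)) ≤ z)
    (hc : c = (1 - Real.exp (-(1 / (8 * z)))) ^ (2 * z))
    (hD0 : 0 < D) (hD1 : (κ + κ ^ 2) / D ≤ δ / 4) (hD2 : κ / D ≤ c / 2)
    (hn : 8 * (z : ℝ) * k ≤ n)
    (hM : (((1 + 2 * D) ^ (r + 1) : ℕ) : ℝ) ≤ δ / (8 * (1 + δ)) * (n / k))
    (v : Fin n) (Z : Set (Finset (Sym2 (Fin n))))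
    (hZ : ∀ S ∉ Z, UniquePaths (fromEdgeSet (S : Set (Sym2 (Fin n)))) v (r + 1)) :
    ∃ K : Bool → Finset (Fin n), (∀ g, K g ⊆ labelClass σ (σ v)) ∧
      Disjoint (K true) (K false) ∧
      c / 4 - bprob q Z ≤
        bprob q (growsUntil (labelClass σ (σ v)) K D v z (1 + δ / 4) r \ Z) := by
  have hk' : (0 : ℝ) < k := by exact_mod_cast hk
  have hk1 : (1 : ℝ) ≤ k := by exact_mod_cast hk
  have hz' : (0 : ℝ) < z := by exact_mod_cast hz0
  have hz1 : (1 : ℝ) ≤ z := by exact_mod_cast hz0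
  have hn' : (0 : ℝ) < n := lt_of_lt_of_le (by positivity) hn
  set C := labelClass σ (σ v) with hC
  set η := δ / (8 * (1 + δ)) with hη
  have hη0 : 0 < η := by positivity
  have hη1 : η ≤ 1 / 8 := by
    rw [hη, div_le_div_iff₀ (by positivity) (by norm_num)]
    linarith
  -- The mean within the class is at least `1 + δ`. Imbalance and seen nodes each remove a fraction
  -- `η`, together `δ / 4`; truncation removes at most another `δ / 4`. This leaves `m = 1 + δ / 2`,
  -- above the growth rate `μ = 1 + δ / 4`.
  have hηδ : 2 * η * (1 + δ) = δ / 4 := by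
    rw [hη]
    field_simp
    norm_num
  have hnk : 0 < (n : ℝ) / k := by positivity
  have hcard := abs_le.1 (hσ (σ v))
  have hCl : (1 - η) * (n / k) ≤ (C.card : ℝ) := by linarith [hcard.1]
  have hCu : (C.card : ℝ) ≤ (1 + η) * (n / k) := by linarith [hcard.2]
  have hq_in : ∀ u ∈ C, ∀ w ∈ C, (q s(u, w) : ℝ) = (b + (1 + δ) * k) / n := by
    intro u hu w hw
    rw [hq, if_pos ((mem_labelClass.1 hw).trans (mem_labelClass.1 hu).symm)]
  have hvC : v ∈ C := mem_labelClass.2 rfl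
  have hunit : (1 + δ) ≤ (n : ℝ) / k * ((b + (1 + δ) * k) / n) := by
    rw [div_mul_div_comm, mul_comm (k : ℝ) n, mul_div_mul_left _ _ hn'.ne', le_div_iff₀ hk']
    linarith
  have hunit' : (n : ℝ) / k * ((b + (1 + δ) * k) / n) ≤ 1 + δ + b := by
    rw [div_mul_div_comm, mul_comm (k : ℝ) n, mul_div_mul_left _ _ hn'.ne', div_le_iff₀ hk']
    linarith [le_mul_of_one_le_right hb hk1]
  have hp0 : 0 ≤ (b + (1 + δ) * k) / (n : ℝ) := by positivity
  -- the expected degrees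
  have hdeg : ∀ u ∈ C, ∑ w, (q s(u, w) : ℝ) ≤ κ := by
    intro u hu
    have h1 : ∀ w, (q s(u, w) : ℝ) ≤
        (if w ∈ C then (b + (1 + δ) * k) / n else 0) + b / n := by
      intro w
      have : 0 ≤ b / (n : ℝ) := by positivity
      by_cases hw : w ∈ C
      · rw [hq_in u hu w hw, if_pos hw]
        linarith
      · rw [hq, if_neg hw, if_neg, zero_add]
        exact fun h => hw (mem_labelClass.2 (h.trans (mem_labelClass.1 hu)))
    refine (Finset.sum_le_sum fun w _ => h1 w).trans ?_
    rw [Finset.sum_add_distrib, Finset.sum_ite_mem, Finset.univ_inter, Finset.sum_const,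
      Finset.sum_const, Finset.card_univ, Fintype.card_fin, nsmul_eq_mul, nsmul_eq_mul,
      mul_div_cancel₀ _ hn'.ne', hκ]
    have h2 : (C.card : ℝ) * ((b + (1 + δ) * k) / n) ≤
        (1 + η) * ((n : ℝ) / k * ((b + (1 + δ) * k) / n)) := by
      rw [← mul_assoc]
      exact mul_le_mul_of_nonneg_right hCu hp0
    have h3 : (1 + η) * ((n : ℝ) / k * ((b + (1 + δ) * k) / n)) ≤ (1 + η) * (1 + δ + b) := by
      gcongr
    linarith [mul_le_mul_of_nonneg_right hη1 (show 0 ≤ 1 + δ + b by positivity)]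
  have hκ0 : 0 ≤ κ := by rw [hκ]; positivity
  -- the expected number of unexplored neighbors in the class
  have hm : ∀ u ∈ C, ∀ B : Finset (Fin n), B.card ≤ (1 + 2 * D) ^ (r + 1) →
      (1 + δ / 2) + (κ + κ ^ 2) / D ≤ ∑ w ∈ C \ B, (q s(u, w) : ℝ) := by
    intro u hu B hB
    rw [Finset.sum_congr rfl fun w hw => hq_in u hu w (Finset.mem_sdiff.1 hw).1,
      Finset.sum_const, nsmul_eq_mul]
    have h1 : (C.card : ℝ) - B.card ≤ ((C \ B).card : ℝ) := by
      have := Finset.le_card_sdiff B C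
      have h2 : C.card ≤ (C \ B).card + B.card := by omega
      have h3 : (C.card : ℝ) ≤ ((C \ B).card : ℝ) + B.card := by exact_mod_cast h2
      linarith
    have h2 : (B.card : ℝ) ≤ η * (n / k) := le_trans (by exact_mod_cast hB) hM
    have h3 : (1 - 2 * η) * (n / k) ≤ ((C \ B).card : ℝ) := by linarith
    have h4 : (1 - 2 * η) * (1 + δ) ≤ ((C \ B).card : ℝ) * ((b + (1 + δ) * k) / n) := by
      calc (1 - 2 * η) * (1 + δ) ≤ (1 - 2 * η) * (n / k * ((b + (1 + δ) * k) / n)) :=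
            mul_le_mul_of_nonneg_left hunit (by linarith)
        _ = ((1 - 2 * η) * (n / k)) * ((b + (1 + δ) * k) / n) := by ring
        _ ≤ _ := mul_le_mul_of_nonneg_right h3 hp0
    linarith
  -- the blocks of neighbors of the root
  set t : ℕ := ⌊(n : ℝ) / (4 * k * z)⌋₊ with ht
  -- The upper bound makes `2 * z` blocks of size `t` fit into half of `n / k`; the lower bound
  -- below gives each block expected degree at least `1 / (8 * z)`.
  have ht1 : (t : ℝ) ≤ n / (4 * k * z) := Nat.floor_le (by positivity)
  have ht2 : (n : ℝ) / (8 * k * z) ≤ t := by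
    have h1 := Nat.lt_floor_add_one ((n : ℝ) / (4 * k * z))
    have h2 : (1 : ℝ) ≤ n / (8 * k * z) := by
      rw [le_div_iff₀ (by positivity)]
      linarith
    have h3 : (n : ℝ) / (4 * k * z) = 2 * (n / (8 * k * z)) := by
      field_simp
      norm_num
    rw [h3] at h1
    have : ⌊2 * ((n : ℝ) / (8 * k * z))⌋₊ = t := by rw [ht, h3]
    rw [this] at h1
    linarith
  have htC : 2 * z * t ≤ (C.erase v).card := by
    rw [Finset.card_erase_of_mem hvC]
    have h1 : 2 * (z : ℝ) * t ≤ n / k / 2 := by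
      calc 2 * (z : ℝ) * t ≤ 2 * z * (n / (4 * k * z)) := by gcongr
        _ = n / k / 2 := by field_simp; norm_num
    have h2 : (8 : ℝ) ≤ n / k := by
      rw [le_div_iff₀ hk']
      linarith [le_mul_of_one_le_left hk'.le hz1]
    have h3 : 2 * (z : ℝ) * t + 1 ≤ C.card := by
      linarith [mul_le_mul_of_nonneg_right hη1 hnk.le]
    have h4 : 2 * z * t + 1 ≤ C.card := by exact_mod_cast h3
    omega
  obtain ⟨B₀, hB1, hB2, hB3⟩ := exists_disjoint_family (C.erase v) (2 * z) t htC
  let e : Bool × Fin z ≃ Fin (2 * z) := Fintype.equivFinOfCardEq (by simp)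
  refine ⟨fun g => Finset.univ.biUnion fun i => B₀ (e (g, i)), fun g => ?_, ?_, ?_⟩
  · refine Finset.biUnion_subset.2 fun i _ => (hB1 _).trans (Finset.erase_subset _ _)
  · rw [Finset.disjoint_biUnion_left]
    intro i _
    rw [Finset.disjoint_biUnion_right]
    intro j _
    refine hB3 _ _ fun h => ?_
    simpa using congrArg Prod.fst (e.injective h)
  · set K : Bool → Finset (Fin n) := fun g => Finset.univ.biUnion fun i => B₀ (e (g, i)) with hK
    have hKC : ∀ g, K g ⊆ C := fun g =>
      Finset.biUnion_subset.2 fun i _ => (hB1 _).trans (Finset.erase_subset _ _)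
    have h0 := bprob_growsUntil_zero_ge (C := C) (K := K) (D := D) (v := v) q (κ := κ)
      (ξ := 1 / (8 * z)) (μ := 1 + δ / 4) hD0 (fun x => B₀ (e x))
      (fun x => Finset.subset_biUnion_of_mem (fun i => B₀ (e (x.1, i))) (Finset.mem_univ x.2))
      (fun x hx => Finset.notMem_erase v C (hB1 _ hx))
      (fun x y hxy => hB3 _ _ fun h => hxy (e.injective h)) (by positivity) (by
        intro x
        rw [Finset.sum_congr rfl fun w hw =>
          hq_in v hvC w (Finset.mem_of_mem_erase (hB1 _ hw)), Finset.sum_const, hB2,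
          nsmul_eq_mul]
        calc 1 / (8 * (z : ℝ)) ≤ 1 / (8 * z) * (1 + δ) := by
              refine le_mul_of_one_le_right (by positivity) (by linarith)
          _ ≤ 1 / (8 * z) * (n / k * ((b + (1 + δ) * k) / n)) := by gcongr
          _ = n / (8 * k * z) * ((b + (1 + δ) * k) / n) := by field_simp
          _ ≤ _ := mul_le_mul_of_nonneg_right ht2 hp0) (hdeg v hvC)
    have h1 := bprob_growsUntil_ge (C := C) (K := K) (D := D) (v := v) q (κ := κ)
      (m := 1 + δ / 2) (μ := 1 + δ / 4) (z := z) r Z le_rfl hD0 hκ0 hz' (by linarith) hdeg hKC hm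
      (by linarith) (by
        refine le_trans (le_of_eq ?_) hz
        congr 1
        ring) (fun S hS j hj g => card_exploration_succ (hZ S hS) j (by omega) g)
    -- A good start has probability at least `c - κ / D ≥ c / 2`, and the growth keeps half of it.
    rw [← hc] at h0
    linarith

/-- If revealed nodes are found in both groups, the label of `v` is the only candidate. -/
theorem candidateLabels_eq_singleton {σ : Fin n → Fin k} {v : Fin n} {K : Bool → Finset (Fin n)}
    {D r : ℕ} (hD : 1 ≤ D) (hK : ∀ g, K g ⊆ labelClass σ (σ v))
    (hd : Disjoint (K true) (K false))
    {S : Finset (Sym2 (Fin n))} {R : Finset (Fin n)}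
    (hS : UniquePaths (fromEdgeSet (S : Set (Sym2 (Fin n)))) v (r + 2))
    (hF : ¬ HasForeignPair σ v (r + 1) (fromEdgeSet (S : Set (Sym2 (Fin n)))))
    (hR : ∀ g, ¬ Disjoint ((exploration (labelClass σ (σ v)) K D v S r).2 g) R) :
    candidateLabels (neighborhood (fromEdgeSet (S : Set (Sym2 (Fin n)))) v (r + 1))
      (observedNear (fromEdgeSet (S : Set (Sym2 (Fin n))))
        (LabeledGraph.observed ⟨fromEdgeSet (S : Set (Sym2 (Fin n))), σ, R⟩) v (r + 1))
      D (r + 1) v = {σ v} := by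
  refine Finset.Subset.antisymm (fun l hl => ?_) ?_
  · rw [Finset.mem_singleton]
    by_contra hne
    refine hF (hasForeignPair_of_mem_candidateLabels (fun u l h => ?_) hl hne)
    rw [LabeledGraph.observed] at h
    split_ifs at h
    simpa using h
  · rw [Finset.singleton_subset_iff]
    have hfound : ∀ g, ∃ x ∈ (exploration (labelClass σ (σ v)) K D v S r).2 g,
        LabeledGraph.observed ⟨fromEdgeSet (S : Set (Sym2 (Fin n))), σ, R⟩ x =
          some (σ v) := by
      intro g
      obtain ⟨x, hx, hxR⟩ := Finset.not_disjoint_iff.1 (hR g)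
      refine ⟨x, hx, ?_⟩
      rw [LabeledGraph.observed, if_pos hxR]
      exact congrArg some (mem_labelClass.1 (exploration_group_subset hK S r g hx))
    obtain ⟨x, hx, hxo⟩ := hfound true
    obtain ⟨y, hy, hyo⟩ := hfound false
    -- State `r` of the exploration holds nodes at distance `r + 1`, the radius of the algorithm
    -- here.
    obtain ⟨P, hP, hPl, hPK, hPD⟩ := exists_path_degree_le hS r (by omega) true hx
    obtain ⟨Q, hQ, hQl, hQK, hQD⟩ := exists_path_degree_le hS r (by omega) false hy
    exact hS.mem_candidateLabels hD hxo hyo hP hQ hPl hQl hPD hQD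
      fun h => Finset.disjoint_left.1 hd hPK (h ▸ hQK)

/-- Two large sets both meet the revealed set. -/
theorem bprob_revealed_ge {V : Type*} [Fintype V] [DecidableEq V] (p : unitInterval) {N : ℕ}
    (hN : (1 - (p : ℝ)) ^ N ≤ 1 / 4) {v : V} {U : Bool → Finset V} (hU : ∀ g, N ≤ (U g).card)
    (hv : ∀ g, v ∉ U g) :
    (1 - (p : ℝ)) / 2 ≤ bprob (fun _ : V => p) {R | v ∉ R ∧ ∀ g, ¬ Disjoint (U g) R} := by
  have hp0 : 0 ≤ 1 - (p : ℝ) := sub_nonneg.2 p.2.2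
  have hp1 : 1 - (p : ℝ) ≤ 1 := by linarith [p.2.1]
  have hsub : {R : Finset V | Disjoint {v} R} ⊆ {R | v ∉ R ∧ ∀ g, ¬ Disjoint (U g) R} ∪
      ({R | Disjoint (insert v (U true)) R} ∪ {R | Disjoint (insert v (U false)) R}) := by
    intro R hR
    have hvR : v ∉ R := Finset.disjoint_singleton_left.1 hR
    by_cases h : ∀ g, ¬ Disjoint (U g) R
    · exact Or.inl ⟨hvR, h⟩
    · push Not at h
      obtain ⟨g, hg⟩ := h
      have hins : Disjoint (insert v (U g)) R := Finset.disjoint_insert_left.2 ⟨hvR, hg⟩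
      cases g
      · exact Or.inr (Or.inr hins)
      · exact Or.inr (Or.inl hins)
  have h1 := (bprob_mono (fun _ => p) hsub).trans ((bprob_union_le _ _ _).trans
    (add_le_add le_rfl (bprob_union_le _ _ _)))
  -- Including `v` in the avoided set keeps the factor `1 - p`, so the bound is relative to the
  -- probability that `v` is not revealed.
  have h2 : ∀ g, bprob (fun _ => p) {R | Disjoint (insert v (U g)) R} ≤ (1 - (p : ℝ)) / 4 := by
    intro g
    rw [bprob_disjoint, Finset.prod_const, Finset.card_insert_of_notMem (hv g), pow_succ]
    have := (pow_le_pow_of_le_one hp0 hp1 (hU g)).trans hN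
    nlinarith
  rw [bprob_disjoint, Finset.prod_singleton] at h1
  linarith [h2 true, h2 false]

end Success

/-! ### Choice of the constants. -/

section Core

open SimpleGraph

variable {n k : ℕ}

/-- The node `v` is not revealed, and the true label is the only candidate. -/
def IdentifiesLabel (σ : Fin n → Fin k) (D r : ℕ) (v : Fin n) (S : Finset (Sym2 (Fin n)))
    (R : Finset (Fin n)) : Prop :=
  v ∉ R ∧ candidateLabels (neighborhood (fromEdgeSet (S : Set (Sym2 (Fin n)))) v r)
    (observedNear (fromEdgeSet (S : Set (Sym2 (Fin n))))
      (LabeledGraph.observed ⟨fromEdgeSet (S : Set (Sym2 (Fin n))), σ, R⟩) v r) D r v = {σ v}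

/-- The failure bound for the uniqueness of paths vanishes as the number of nodes grows. -/
theorem sum_pow_mul_pow_le {a c : ℝ} (hc : 0 < c) (L : ℕ) :
    ∃ n₀ : ℕ, ∀ n ≥ n₀, 0 < n →
      ∑ l : Fin (2 * L + 1), ∑ _j : Fin (2 * L + 1),
        (n : ℝ) ^ (l : ℕ) * (a / n) ^ ((l : ℕ) + 1) ≤ c := by
  set A := ∑ l : Fin (2 * L + 1), ∑ _j : Fin (2 * L + 1), a ^ ((l : ℕ) + 1) with hA
  obtain ⟨n₀, hn₀⟩ := exists_nat_ge (A / c)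
  refine ⟨n₀, fun n hn hn0 => ?_⟩
  have hn' : (0 : ℝ) < n := by exact_mod_cast hn0
  have e : ∑ l : Fin (2 * L + 1), ∑ _j : Fin (2 * L + 1),
        (n : ℝ) ^ (l : ℕ) * (a / n) ^ ((l : ℕ) + 1) = A / n := by
    rw [hA, Finset.sum_div]
    refine Finset.sum_congr rfl fun l _ => ?_
    rw [Finset.sum_div]
    refine Finset.sum_congr rfl fun j _ => ?_
    rw [div_pow, pow_succ (n : ℝ)]
    field_simp
  rw [e, div_le_iff₀ hn', ← div_le_iff₀' hc]
  exact hn₀.trans (by exact_mod_cast hn)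

/-- The order of choices matters: `κ`, `z`, `c`, `D` come from `b` and `δ` alone; `p` then fixes `N`
and the depth, the depth fixes `kstar`, and `n₀` comes last. Growth has probability at least `c / 4`
minus that of non-unique paths; the latter and foreign pairs cost at most `c / 16` each. The
remaining `c / 8` times `(1 - p) / 2` gives `ε = c / 16`. -/
theorem exists_identifiesLabel {b δ : ℝ} (hb : 0 ≤ b) (hδ : 0 < δ) :
    ∃ ε : ℝ, 0 < ε ∧ ε ≤ 1 ∧ ∃ D : ℕ, ∀ p : unitInterval, 0 < p →
      ∃ r kstar : ℕ, ∀ k : ℕ, 0 < k → kstar ≤ k → ∃ n₀ : ℕ, ∀ n : ℕ, 0 < n → n₀ ≤ n →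
        ∀ σ : Fin n → Fin k, BalancedLabels (δ / (8 * (1 + δ))) σ → ∀ v : Fin n,
          ε * (1 - p) ≤ bexp (edgeProbability (b + (1 + δ) * k) b σ) fun S =>
            bprob (fun _ : Fin n => p) {R | IdentifiesLabel σ D r v S R} := by
  obtain ⟨κ, hκ⟩ : ∃ κ : ℝ, κ = 3 * (1 + δ + b) := ⟨_, rfl⟩
  have hκ0 : 0 < κ := by rw [hκ]; positivity
  obtain ⟨z₀, hz₀⟩ := exists_nat_ge (4 * (κ + κ ^ 2) * (1 + δ / 4) / ((δ / 4) ^ 2 * (δ / 4)))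
  set z := z₀ + 1 with hzdef
  have hz : 4 * (κ + κ ^ 2) * (1 + δ / 4) / ((δ / 4) ^ 2 * (δ / 4)) ≤ (z : ℝ) :=
    hz₀.trans (by rw [hzdef]; push_cast; linarith)
  have hz0 : 0 < z := Nat.succ_pos z₀
  have hz' : (0 : ℝ) < z := by exact_mod_cast hz0
  have hz1 : (1 : ℝ) ≤ z := by exact_mod_cast hz0
  obtain ⟨c, hc⟩ : ∃ c : ℝ, c = (1 - Real.exp (-(1 / (8 * z)))) ^ (2 * z) := ⟨_, rfl⟩
  have hexp : Real.exp (-(1 / (8 * (z : ℝ)))) < 1 := by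
    rw [Real.exp_lt_one_iff, neg_lt_zero]
    positivity
  have hc0 : 0 < c := by
    rw [hc]
    exact pow_pos (by linarith) _
  have hc1 : c ≤ 1 := by
    rw [hc]
    exact pow_le_one₀ (by linarith) (by linarith [Real.exp_pos (-(1 / (8 * (z : ℝ))))])
  obtain ⟨D₀, hD₀⟩ := exists_nat_ge (max ((κ + κ ^ 2) / (δ / 4)) (κ / (c / 2)))
  set D := D₀ + 1 with hD
  have hD0 : 0 < D := Nat.succ_pos D₀
  have hD' : (0 : ℝ) < D := by exact_mod_cast hD0
  have hDD : (D₀ : ℝ) ≤ D := by rw [hD]; push_cast; linarith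
  have hD1 : (κ + κ ^ 2) / D ≤ δ / 4 := by
    rw [div_le_iff₀ hD', ← div_le_iff₀' (by positivity)]
    exact (le_max_left _ _).trans (hD₀.trans hDD)
  have hD2 : κ / D ≤ c / 2 := by
    rw [div_le_iff₀ hD', ← div_le_iff₀' (by positivity)]
    exact (le_max_right _ _).trans (hD₀.trans hDD)
  refine ⟨c / 16, by positivity, by linarith, D, fun p hp => ?_⟩
  have hp' : (0 : ℝ) < p := hp
  have hp0 : 0 ≤ 1 - (p : ℝ) := sub_nonneg.2 p.2.2
  obtain ⟨N, hN⟩ := exists_pow_lt_of_lt_one (show (0 : ℝ) < 1 / 4 by norm_num)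
    (show 1 - (p : ℝ) < 1 by linarith)
  obtain ⟨r, hr⟩ := pow_unbounded_of_one_lt (N : ℝ) (show 1 < 1 + δ / 4 by linarith)
  set Λ := ((3 * b + 2 * (1 + δ)) ^ (r + 1)) ^ 2 with hΛ
  obtain ⟨kstar, hkstar⟩ := exists_nat_ge (Λ / (c / 16))
  refine ⟨r + 1, kstar, fun k hk hkk => ?_⟩
  have hk' : (0 : ℝ) < k := by exact_mod_cast hk
  obtain ⟨n₁, hn₁⟩ := sum_pow_mul_pow_le (a := b + (1 + δ) * k) (c := c / 16)
    (by positivity) (r + 2)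
  set η := δ / (8 * (1 + δ)) with hη
  have hη0 : 0 < η := by positivity
  have hη1 : η ≤ 1 := by
    rw [hη, div_le_one (by positivity)]
    linarith
  obtain ⟨n₂, hn₂⟩ := exists_nat_ge (max (max (b + (1 + δ) * k) (8 * z * k))
    ((((1 + 2 * D) ^ (r + 1) : ℕ) : ℝ) / η * k))
  refine ⟨max n₁ n₂, fun n hn hnn σ hσ v => ?_⟩
  have hn' : (0 : ℝ) < n := by exact_mod_cast hn
  have hle2 : (n₂ : ℝ) ≤ n := by exact_mod_cast (le_max_right _ _).trans hnn
  have hbig := hn₂.trans hle2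
  have han : b + (1 + δ) * k ≤ n := (le_max_left _ _).trans ((le_max_left _ _).trans hbig)
  have h8 : 8 * (z : ℝ) * k ≤ n := (le_max_right _ _).trans ((le_max_left _ _).trans hbig)
  have hM : (((1 + 2 * D) ^ (r + 1) : ℕ) : ℝ) ≤ η * (n / k) := by
    have := (le_max_right _ _).trans hbig
    rw [← le_div_iff₀ hk', div_le_iff₀ hη0] at this
    linarith
  set q := edgeProbability (b + (1 + δ) * k) b σ with hqdef
  have hq : ∀ u w, (q s(u, w) : ℝ) = if σ w = σ u then (b + (1 + δ) * k) / n else b / n :=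
    edgeProbability_mk (by positivity) hb han (le_trans (le_add_of_nonneg_right (by positivity)) han)
      σ
  -- Uniqueness is required one step beyond the radius `r + 1`, so that nodes at maximal distance
  -- are leaves.
  set Z : Set (Finset (Sym2 (Fin n))) :=
    {S | ¬ UniquePaths (fromEdgeSet (S : Set (Sym2 (Fin n)))) v (r + 2)} with hZ
  have hZle : bprob q Z ≤ c / 16 := by
    refine (bprob_not_uniquePaths_le q v (r + 2) (β := (b + (1 + δ) * k) / n) (by positivity)
      fun e => ?_).trans ?_
    · induction e with
      | _ u w =>
        rw [hq]
        split_ifs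
        · exact le_rfl
        · gcongr
          exact le_add_of_nonneg_right (by positivity)
    · rw [Fintype.card_fin]
      exact hn₁ n ((le_max_left _ _).trans hnn) hn
  have hforeign := bprob_hasForeignPair_le_div hb hδ.le hn hk hq (fun s => by
    have := (abs_le.1 (hσ s)).2
    have h2 : η * ((n : ℝ) / k) ≤ 1 * (n / k) := by gcongr
    linarith) (r + 1) v
  have hforeign' : Λ / k ≤ c / 16 := by
    rw [div_le_iff₀ hk', ← div_le_iff₀' (by positivity)]
    exact hkstar.trans (by exact_mod_cast hkk)
  obtain ⟨K, hKC, hKd, hgrow⟩ := exists_bprob_growsUntil_ge hb hδ hk q hq hσ hκ hz0 hz hc hD0 hD1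
    hD2 h8 hM v Z (fun S hS => fun x P Q hP hQ hPl hQl => by
      have : UniquePaths (fromEdgeSet (S : Set (Sym2 (Fin n)))) v (r + 2) := not_not.1 hS
      exact this x P Q hP hQ (by omega) (by omega))
  set F : Set (Finset (Sym2 (Fin n))) :=
    {S | HasForeignPair σ v (r + 1) (fromEdgeSet (S : Set (Sym2 (Fin n))))} with hF
  set G := growsUntil (labelClass σ (σ v)) K D v z (1 + δ / 4) r \ Z with hG
  have hGF : c / 8 ≤ bprob q (G \ F) := by
    have h1 : G ⊆ (G \ F) ∪ F := fun S hS => by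
      by_cases h : S ∈ F
      · exact Or.inr h
      · exact Or.inl ⟨hS, h⟩
    have h2 := (bprob_mono q h1).trans (bprob_union_le q _ _)
    linarith
  refine le_trans ?_ (bprob_mul_le q (E := G \ F) (c := (1 - (p : ℝ)) / 2)
    (fun S => bprob_nonneg _ _) fun S hS => ?_)
  · linarith [mul_le_mul_of_nonneg_left hGF hp0]
  · obtain ⟨⟨hgr, hSZ⟩, hSF⟩ := hS
    have hU : ∀ g, N ≤ ((exploration (labelClass σ (σ v)) K D v S r).2 g).card := by
      intro g
      have h1 := hgr r le_rfl g
      have h2 : (1 + δ / 4) ^ r ≤ z * (1 + δ / 4) ^ r :=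
        le_mul_of_one_le_left (by positivity) hz1
      exact_mod_cast hr.le.trans (h2.trans h1)
    refine (bprob_revealed_ge p hN.le hU fun g hvg =>
      exploration_group_notMem S r g hvg (root_mem_explored S r)).trans (bprob_mono _ ?_)
    rintro R ⟨hvR, hR⟩
    exact ⟨hvR, candidateLabels_eq_singleton hD0 hKC hKd (not_not.1 hSZ) hSF hR⟩

end Core

/-! ### From the law of a run to finite expectations, and the conclusion. -/

section RunLaw

variable {α β : Type*}

theorem probability_bind [Fintype α] (μ : PMF α) (f : α → PMF β) (P : β → Prop) :
    probability (μ.bind f) P = ∑ x, (μ x).toReal * probability (f x) P := by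
  rw [probability, PMF.toOuterMeasure_bind_apply, tsum_fintype, ENNReal.toReal_sum]
  · simp only [ENNReal.toReal_mul, probability]
  · intro x _
    refine ENNReal.mul_ne_top (PMF.apply_ne_top μ x) ?_
    exact ne_top_of_le_ne_top ENNReal.one_ne_top
      (by rw [PMF.toOuterMeasure_apply]
          refine (ENNReal.tsum_le_tsum fun y => Set.indicator_le_self _ _ y).trans ?_
          rw [PMF.tsum_coe])

theorem probability_map (μ : PMF α) (f : α → β) (P : β → Prop) :
    probability (μ.map f) P = probability μ fun x => P (f x) := by
  rw [probability, PMF.toOuterMeasure_map_apply]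
  rfl

theorem probability_nonneg (μ : PMF α) (P : α → Prop) : 0 ≤ probability μ P :=
  ENNReal.toReal_nonneg

theorem probability_eq_one (μ : PMF α) {P : α → Prop} (h : ∀ x, P x) : probability μ P = 1 := by
  have : {x | P x} = Set.univ := Set.eq_univ_of_forall h
  rw [probability, this, (PMF.toOuterMeasure_apply_eq_one_iff μ _).2 (Set.subset_univ _)]
  rfl

theorem probability_eq_zero (μ : PMF α) {P : α → Prop} (h : ∀ x, ¬ P x) : probability μ P = 0 := by
  have : {x | P x} = ∅ := Set.eq_empty_of_forall_notMem h
  rw [probability, this]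
  simp

theorem probability_pure (x : α) {P : α → Prop} (h : P x) : probability (PMF.pure x) P = 1 := by
  rw [probability, (PMF.toOuterMeasure_apply_eq_one_iff _ _).2]
  · rfl
  · rw [PMF.support_pure]
    exact Set.singleton_subset_iff.2 h

theorem sum_randomSubset {ι : Type*} [Fintype ι] [DecidableEq ι] (q : ι → unitInterval)
    (f : Finset ι → ℝ) : ∑ S, (randomSubset q S).toReal * f S = bexp q f := by
  refine Finset.sum_congr rfl fun S _ => ?_
  rw [randomSubset, PMF.ofFintype_apply, ENNReal.toReal_mul, ENNReal.toReal_prod,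
    ENNReal.toReal_prod]
  congr 2
  · exact Finset.prod_congr rfl fun i _ => ENNReal.toReal_ofReal (q i).2.1
  · exact Finset.prod_congr rfl fun i _ => ENNReal.toReal_ofReal (sub_nonneg.2 (q i).2.2)

variable {n k : ℕ} [NeZero n] [NeZero k]

/-- The expectation of a function of the sample and of the uniformly random node. -/
noncomputable def sampleMean (a b : ℝ) (p : unitInterval)
    (φ : (Fin n → Fin k) → Finset (Sym2 (Fin n)) → Finset (Fin n) → Fin n → ℝ) : ℝ :=
  ∑ σ : Fin n → Fin k, ((k : ℝ) ^ n)⁻¹ *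
    bexp (edgeProbability a b σ) fun S => bexp (fun _ : Fin n => p) fun R =>
      ∑ v, (n : ℝ)⁻¹ * φ σ S R v

omit [NeZero n] [NeZero k] in
theorem sampleMean_mono {a b : ℝ} {p : unitInterval}
    {φ ψ : (Fin n → Fin k) → Finset (Sym2 (Fin n)) → Finset (Fin n) → Fin n → ℝ}
    (h : ∀ σ S R v, φ σ S R v ≤ ψ σ S R v) : sampleMean a b p φ ≤ sampleMean a b p ψ := by
  refine Finset.sum_le_sum fun σ _ => mul_le_mul_of_nonneg_left ?_ (by positivity)
  refine bexp_mono _ fun S => bexp_mono _ fun R => Finset.sum_le_sum fun v _ => ?_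
  exact mul_le_mul_of_nonneg_left (h σ S R v) (by positivity)

omit [NeZero n] [NeZero k] in
theorem sampleMean_add {a b : ℝ} {p : unitInterval}
    (φ ψ : (Fin n → Fin k) → Finset (Sym2 (Fin n)) → Finset (Fin n) → Fin n → ℝ) :
    sampleMean a b p (fun σ S R v => φ σ S R v + ψ σ S R v) =
      sampleMean a b p φ + sampleMean a b p ψ := by
  simp only [sampleMean, mul_add, Finset.sum_add_distrib, bexp_add]

theorem sampleMean_one (a b : ℝ) (p : unitInterval) :
    sampleMean a b p (fun (_ : Fin n → Fin k) _ _ _ => 1) = 1 := by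
  have hn : (n : ℝ) ≠ 0 := by exact_mod_cast NeZero.ne n
  have hk : (k : ℝ) ≠ 0 := by exact_mod_cast NeZero.ne k
  simp only [sampleMean, bexp_const, Finset.sum_const, Finset.card_univ, Fintype.card_fin,
    nsmul_eq_mul, Fintype.card_pi, Finset.prod_const, mul_one]
  push_cast
  field_simp

omit [NeZero n] [NeZero k] in
theorem sampleMean_eq (a b : ℝ) (p : unitInterval)
    (φ : (Fin n → Fin k) → Finset (Sym2 (Fin n)) → Finset (Fin n) → Fin n → ℝ) :
    sampleMean a b p φ = ∑ σ : Fin n → Fin k, ((k : ℝ) ^ n)⁻¹ * ∑ v, (n : ℝ)⁻¹ *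
      bexp (edgeProbability a b σ) fun S => bexp (fun _ : Fin n => p) fun R => φ σ S R v := by
  refine Finset.sum_congr rfl fun σ _ => ?_
  simp only [bexp_sum, bexp_const_mul]

/-- The law of the output at the node `v` of a given sample. -/
noncomputable def outputLaw (D r : ℕ) (σ : Fin n → Fin k) (S : Finset (Sym2 (Fin n)))
    (R : Finset (Fin n)) (v : Fin n) : PMF (Option (Fin k)) :=
  localAlgorithm (SimpleGraph.fromEdgeSet (S : Set (Sym2 (Fin n))))
    (LabeledGraph.observed ⟨SimpleGraph.fromEdgeSet (S : Set (Sym2 (Fin n))), σ, R⟩) D r v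

theorem probability_runLaw (a b : ℝ) (p : unitInterval) (D r : ℕ) (P : Run n k → Prop) :
    probability (runLaw n k a b p D r) P = sampleMean a b p fun σ S R v =>
      probability (outputLaw D r σ S R v) fun o =>
        P ⟨⟨SimpleGraph.fromEdgeSet (S : Set (Sym2 (Fin n))), σ, R⟩, v, o⟩ := by
  simp only [runLaw, labeledBlockModel, PMF.bind_bind, PMF.bind_map, Function.comp_def]
  rw [probability_bind, sampleMean]
  refine Finset.sum_congr rfl fun σ _ => ?_
  rw [probability_bind, sum_randomSubset]
  congr 1
  · simp [PMF.uniformOfFintype_apply]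
  congr 1
  funext S
  rw [probability_bind, sum_randomSubset]
  congr 1
  funext R
  rw [probability_bind]
  refine Finset.sum_congr rfl fun v _ => ?_
  rw [probability_map]
  congr 1
  simp [PMF.uniformOfFintype_apply]

omit [NeZero n] [NeZero k] in
theorem outputLaw_of_mem {D r : ℕ} {σ : Fin n → Fin k} {S : Finset (Sym2 (Fin n))}
    {R : Finset (Fin n)} {v : Fin n} (hv : v ∈ R) :
    outputLaw D r σ S R v = PMF.pure (some (σ v)) := by
  have : observedNear (SimpleGraph.fromEdgeSet (S : Set (Sym2 (Fin n))))
      (LabeledGraph.observed ⟨SimpleGraph.fromEdgeSet (S : Set (Sym2 (Fin n))), σ, R⟩) v r v =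
      some (σ v) := by
    rw [observedNear, if_pos (by simp), LabeledGraph.observed, if_pos hv]
  rw [outputLaw, localAlgorithm, chooseLabel]
  simp only [this]

omit [NeZero n] [NeZero k] in
theorem outputLaw_of_identifiesLabel {D r : ℕ} {σ : Fin n → Fin k} {S : Finset (Sym2 (Fin n))}
    {R : Finset (Fin n)} {v : Fin n} (h : IdentifiesLabel σ D r v S R) :
    outputLaw D r σ S R v = PMF.pure (some (σ v)) := by
  obtain ⟨hv, hc⟩ := h
  have : observedNear (SimpleGraph.fromEdgeSet (S : Set (Sym2 (Fin n))))
      (LabeledGraph.observed ⟨SimpleGraph.fromEdgeSet (S : Set (Sym2 (Fin n))), σ, R⟩) v r v =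
      none := by
    rw [observedNear, if_pos (by simp), LabeledGraph.observed, if_neg hv]
  rw [outputLaw, localAlgorithm, chooseLabel]
  simp only [this, hc, Finset.singleton_nonempty, dif_pos]
  have hu : PMF.uniformOfFinset {σ v} (Finset.singleton_nonempty (σ v)) = PMF.pure (σ v) := by
    ext x
    by_cases hx : x = σ v
    · subst hx
      simp
    · simp [hx]
  rw [hu, PMF.pure_map]

/-- Revealed nodes are always labeled correctly. -/
theorem probability_correct_ge (a b : ℝ) (p : unitInterval) (D r : ℕ) :
    1 + probability (runLaw n k a b p D r) (fun X => ¬ X.IsRevealed ∧ X.Correct) ≤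
      probability (runLaw n k a b p D r) (fun X => X.Correct) +
      probability (runLaw n k a b p D r) (fun X => ¬ X.IsRevealed) := by
  simp only [probability_runLaw]
  rw [← sampleMean_one (n := n) (k := k) a b p, ← sampleMean_add, ← sampleMean_add]
  refine sampleMean_mono fun σ S R v => ?_
  simp only [Run.IsRevealed, Run.Correct]
  -- Pointwise equality: a revealed node gives `1 + 0 = 1 + 0`, any other `1 + x = x + 1`.
  by_cases hv : v ∈ R
  · have h1 := probability_eq_zero (outputLaw D r σ S R v)
      (P := fun o => ¬ v ∈ R ∧ o = some (σ v)) fun o ho => ho.1 hv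
    have h2 := probability_eq_zero (outputLaw D r σ S R v)
      (P := fun _ => ¬ v ∈ R) fun o ho => ho hv
    have h3 : probability (outputLaw D r σ S R v) (fun o => o = some (σ v)) = 1 := by
      rw [outputLaw_of_mem hv]
      exact probability_pure _ rfl
    rw [h1, h2, h3]
  · have h2 := probability_eq_one (outputLaw D r σ S R v)
      (P := fun _ => ¬ v ∈ R) fun o => hv
    simp only [hv, not_false_eq_true, true_and] at h2 ⊢
    rw [h2, add_comm]

theorem probability_not_isRevealed (a b : ℝ) (p : unitInterval) (D r : ℕ) :
    probability (runLaw n k a b p D r) (fun X => ¬ X.IsRevealed) = 1 - p := by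
  have hn : (n : ℝ) ≠ 0 := by exact_mod_cast NeZero.ne n
  have hk : (k : ℝ) ≠ 0 := by exact_mod_cast NeZero.ne k
  have h : ∀ v : Fin n, bexp (fun _ : Fin n => p) ({R : Finset (Fin n) | v ∉ R}.indicator 1) =
      1 - p := by
    intro v
    rw [← bprob, ← bprob_mem (fun _ : Fin n => p) v, ← bprob_compl]
    rfl
  have e : ∀ (σ : Fin n → Fin k) (S : Finset (Sym2 (Fin n))) (R : Finset (Fin n)) (v : Fin n),
      probability (outputLaw D r σ S R v) (fun _ => ¬ v ∈ R) =
        {R : Finset (Fin n) | v ∉ R}.indicator 1 R := by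
    intro σ S R v
    by_cases hv : v ∈ R
    · rw [Set.indicator_of_notMem (by simpa using hv)]
      exact probability_eq_zero _ fun _ h => h hv
    · rw [Set.indicator_of_mem (by simpa using hv)]
      exact probability_eq_one _ fun _ => hv
  rw [probability_runLaw]
  simp only [Run.IsRevealed]
  rw [sampleMean_eq]
  simp only [e, h, bexp_const, Finset.sum_const, Finset.card_univ, Fintype.card_fin,
    nsmul_eq_mul, Fintype.card_pi, Finset.prod_const]
  push_cast
  field_simp

/-- Unbalanced labelings are bounded below by zero; the balanced ones carry at least half of the
mass, hence `ε / 2`. -/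
theorem probability_not_isRevealed_correct_ge {a b : ℝ} {p : unitInterval} {D r : ℕ} {ε η : ℝ}
    (hε : 0 ≤ ε) (hη : 0 < η) (hn : 2 * (k : ℝ) ^ 3 ≤ η ^ 2 * n)
    (h : ∀ σ : Fin n → Fin k, BalancedLabels η σ → ∀ v : Fin n,
      ε * (1 - p) ≤ bexp (edgeProbability a b σ) fun S =>
        bprob (fun _ : Fin n => p) {R | IdentifiesLabel σ D r v S R}) :
    ε / 2 * (1 - p) ≤
      probability (runLaw n k a b p D r) (fun X => ¬ X.IsRevealed ∧ X.Correct) := by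
  classical
  have hn0 : (n : ℝ) ≠ 0 := by exact_mod_cast NeZero.ne n
  have hk0 : (0 : ℝ) < k := by exact_mod_cast NeZero.pos k
  have hp : 0 ≤ 1 - (p : ℝ) := sub_nonneg.2 p.2.2
  have hpt : ∀ (σ : Fin n → Fin k) (S : Finset (Sym2 (Fin n))) (R : Finset (Fin n)) (v : Fin n),
      {R | IdentifiesLabel σ D r v S R}.indicator (1 : Finset (Fin n) → ℝ) R ≤
        probability (outputLaw D r σ S R v) (fun o => ¬ v ∈ R ∧ o = some (σ v)) := by
    intro σ S R v
    by_cases hI : IdentifiesLabel σ D r v S R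
    · rw [Set.indicator_of_mem (by exact hI), outputLaw_of_identifiesLabel hI,
        probability_pure _ ⟨hI.1, rfl⟩]
      exact le_rfl
    · rw [Set.indicator_of_notMem (by exact hI)]
      exact probability_nonneg _ _
  rw [probability_runLaw]
  refine le_trans ?_ (sampleMean_mono fun σ S R v => hpt σ S R v)
  rw [sampleMean_eq]
  have hσ : ∀ σ : Fin n → Fin k, (if BalancedLabels η σ then ((k : ℝ) ^ n)⁻¹ * (ε * (1 - p)) else 0) ≤
      ((k : ℝ) ^ n)⁻¹ * ∑ v, (n : ℝ)⁻¹ * bexp (edgeProbability a b σ) fun S =>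
        bexp (fun _ : Fin n => p)
          fun R => {R | IdentifiesLabel σ D r v S R}.indicator (1 : Finset (Fin n) → ℝ) R := by
    intro σ
    split_ifs with hB
    · refine mul_le_mul_of_nonneg_left ?_ (by positivity)
      calc ε * (1 - (p : ℝ)) = ∑ _v : Fin n, (n : ℝ)⁻¹ * (ε * (1 - p)) := by
            rw [Finset.sum_const, Finset.card_univ, Fintype.card_fin, nsmul_eq_mul]
            field_simp
        _ ≤ _ := Finset.sum_le_sum fun v _ =>
            mul_le_mul_of_nonneg_left (h σ hB v) (by positivity)
    · refine mul_nonneg (by positivity) (Finset.sum_nonneg fun v _ => mul_nonneg (by positivity) ?_)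
      exact bexp_nonneg _ fun S => bprob_nonneg _ _
  refine le_trans ?_ (Finset.sum_le_sum fun σ _ => hσ σ)
  rw [← Finset.sum_filter, Finset.sum_const, nsmul_eq_mul]
  have hcard := card_balanced_ge (n := n) (k := k) hη hn
  have hkn : (0 : ℝ) < (k : ℝ) ^ n := by positivity
  calc ε / 2 * (1 - (p : ℝ)) = ((k : ℝ) ^ n / 2) * (((k : ℝ) ^ n)⁻¹ * (ε * (1 - p))) := by
        field_simp
    _ ≤ _ := by
        refine mul_le_mul_of_nonneg_right ?_ (by positivity)
        convert hcard

end RunLaw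

/-- For large `k` and `n`, the algorithm identifies unrevealed labels with a probability bounded
away from zero, uniformly in the fraction `p` of revealed labels. -/
theorem exists_recovery (b δ : ℝ) (hb : 1 < b) (hδ : 0 < δ) :
      ∃ ε : ℝ, 0 < ε ∧ ∃ D : ℕ,
        ∀ p : unitInterval, 0 < p →
          ∃ r kstar : ℕ, ∀ (k : ℕ) [NeZero k], kstar ≤ k →
            ∃ n₀ : ℕ, ∀ (n : ℕ) [NeZero n], n₀ ≤ n →
              ε * probability (runLaw n k (b + (1 + δ) * k) b p D r) (fun X => ¬ X.IsRevealed) ≤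
                probability (runLaw n k (b + (1 + δ) * k) b p D r)
                  (fun X => ¬ X.IsRevealed ∧ X.Correct) ∧
              ε ≤ probability (runLaw n k (b + (1 + δ) * k) b p D r) (fun X => X.Correct) := by
  obtain ⟨ε, hε, hε1, D, h⟩ := exists_identifiesLabel (b := b) (by linarith) hδ
  refine ⟨ε / 2, by positivity, D, fun p hp => ?_⟩
  obtain ⟨r, kstar, h⟩ := h p hp
  refine ⟨r, kstar, fun k _ hk => ?_⟩
  obtain ⟨n₀, h⟩ := h k (NeZero.pos k) hk
  have hη : 0 < δ / (8 * (1 + δ)) := by positivity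
  obtain ⟨n₁, hn₁⟩ := exists_nat_ge (2 * (k : ℝ) ^ 3 / (δ / (8 * (1 + δ))) ^ 2)
  refine ⟨max n₀ n₁, fun n _ hn => ?_⟩
  have hmain := probability_not_isRevealed_correct_ge (n := n) (k := k)
    (a := b + (1 + δ) * k) (b := b) (p := p) (D := D) (r := r) hε.le hη (by
      rw [← div_le_iff₀' (by positivity)]
      exact hn₁.trans (by exact_mod_cast (le_max_right _ _).trans hn))
    (h n (NeZero.pos n) ((le_max_left _ _).trans hn))
  have hrev := probability_not_isRevealed (n := n) (k := k) (b + (1 + δ) * k) b p D r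
  have hcor := probability_correct_ge (n := n) (k := k) (b + (1 + δ) * k) b p D r
  have hp0 := p.2.1
  rw [hrev] at hcor ⊢
  refine ⟨hmain, ?_⟩
  -- The success probability is at least `p + ε / 2 * (1 - p)`, which is at least `ε / 2` because `ε
  -- ≤ 1`.
  nlinarith

theorem theorem1 :
    (∀ b δ : ℝ, 1 < b → 0 < δ →
      ∃ ε : ℝ, 0 < ε ∧ ∃ D : ℕ,
        ∀ p : unitInterval, 0 < p →
          ∃ r kstar : ℕ, ∀ (k : ℕ) [NeZero k], kstar ≤ k →
            ∃ n₀ : ℕ, ∀ (n : ℕ) [NeZero n], n₀ ≤ n →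
              ε * probability (runLaw n k (b + (1 + δ) * k) b p D r) (fun X => ¬ X.IsRevealed) ≤
                probability (runLaw n k (b + (1 + δ) * k) b p D r)
                  (fun X => ¬ X.IsRevealed ∧ X.Correct) ∧
              ε ≤ probability (runLaw n k (b + (1 + δ) * k) b p D r) (fun X => X.Correct)) ∧
    (∃ b δ : ℝ, 1 < b ∧ 0 < δ ∧
      ∃ ε : ℝ, 0 < ε ∧ ∃ D : ℕ,
        ∀ p : unitInterval, 0 < p →
          ∃ r kstar : ℕ, ∀ (k : ℕ) [NeZero k], kstar ≤ k →
            ((b + (1 + δ) * k) - b) ^ 2 < k * ((b + (1 + δ) * k) + (k - 1) * b) ∧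
            ∃ n₀ : ℕ, ∀ (n : ℕ) [NeZero n], n₀ ≤ n →
              (1 / k + ε) *
                  probability (runLaw n k (b + (1 + δ) * k) b p D r) (fun X => ¬ X.IsRevealed) ≤
                probability (runLaw n k (b + (1 + δ) * k) b p D r)
                  (fun X => ¬ X.IsRevealed ∧ X.Correct) ∧
              1 / k + ε ≤
                probability (runLaw n k (b + (1 + δ) * k) b p D r) (fun X => X.Correct)) := by
  -- For `b = 2` and `δ = 1 / 2` the two sides of the threshold inequality are `9 / 4 * k ^ 2` and
  -- `7 / 2 * k ^ 2`.
  refine ⟨exists_recovery, 2, 1 / 2, by norm_num, by norm_num, ?_⟩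
  obtain ⟨ε, hε, D, h⟩ := exists_recovery 2 (1 / 2) (by norm_num) (by norm_num)
  refine ⟨ε / 2, by positivity, D, fun p hp => ?_⟩
  obtain ⟨r, kstar, h⟩ := h p hp
  -- Beyond this `k`, random guessing succeeds with probability `1 / k ≤ ε / 2`, and the other half
  -- of `ε` is the advantage.
  obtain ⟨k₁, hk₁⟩ := exists_nat_ge (2 / ε)
  refine ⟨r, max kstar k₁, fun k _ hk => ?_⟩
  have hk0 : (0 : ℝ) < k := by exact_mod_cast NeZero.pos k
  have hkε : 1 / (k : ℝ) + ε / 2 ≤ ε := by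
    have h1 : 2 / ε ≤ k := hk₁.trans (by exact_mod_cast (le_max_right _ _).trans hk)
    rw [div_le_iff₀ hε] at h1
    have h2 : 1 / (k : ℝ) ≤ ε / 2 := by
      rw [div_le_div_iff₀ hk0 (by norm_num)]
      linarith
    linarith
  refine ⟨by nlinarith, ?_⟩
  obtain ⟨n₀, h⟩ := h k ((le_max_left _ _).trans hk)
  refine ⟨n₀, fun n _ hn => ?_⟩
  obtain ⟨h1, h2⟩ := h n hn
  exact ⟨(mul_le_mul_of_nonneg_right hkε (probability_nonneg _ _)).trans h1, hkε.trans h2⟩
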